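/- Let $n$ be a positive integer, $\Bbbk$ a commutative ring, $R$ a commutative $\Bbbk$-algebra, $\sigma:\mathbb{Z}^n\to\mathrm{Aut}_{\Bbbk}(R)$, $g\mapsto\sigma_g$, a group homomorphism, $t=(t_1,\dots,t_n)\in R^n$, and $\mu=(\mu_{ij})$ an $n\times n$ matrix of units of $\Bbbk$. Put $\sigma_i=\sigma_{e_i}$, where $e_1,\dots,e_n$ is the standard basis of $\mathbb{Z}^n$. Let $A'$ be the ring generated over $R$ by symbols $X_1,\dots,X_n,Y_1,\dots,Y_n$ subject to $$X_ir=\sigma_i(r)X_i,\quad Y_ir=\sigma_i^{-1}(r)Y_i,\quad Y_iX_i=t_i,\quad X_iY_i=\sigma_i(t_i)\qquad(r\in R,\ 1\le i\le n),$$ $$X_iY_j=\mu_{ij}Y_jX_i\qquad(i\neq j),$$ with the $\mathbb{Z}^n$-grading given by $\deg r=0$ for $r\in R$, $\deg X_i=e_i$, $\deg Y_i=-e_i$. Assume that the natural map $R\to A'$ is injective, so that $R=A'_0$. The twisted generalized Weyl algebra (TGWA) $A=A(R,\sigma,t,\mu)$ is $A'/I$, where $I$ is the sum of all graded two-sided ideals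 $J$ of $A'$ with $J\cap A'_0=0$; it inherits a $\mathbb{Z}^n$-grading $A=\bigoplus_g A_g$ from $A'$, with $A_0=R$. Assume that: * $A$ is regularly graded: every $A_g$, $g\in\mathbb{Z}^n$, contains an element that is neither a left nor a right zero divisor in $A$; * $A$ is $R$-finitistic: for all $i\ne j$ there are $k\ge 0$ and $s_1,\dots,s_k\in R$ with $$\sigma_i^k(t_j)+s_1\sigma_i^{k-1}(t_j)+\dots+s_kt_j=0,\qquad(1)$$ and there are $m\ge 0$ and $s'_1,\dots,s'_m\in R$ with $$t_j+s'_1\sigma_i(t_j)+\dots+s'_m\sigma_i^m(t_j)=0;\qquad(2)$$ * $A$ is of Lie type $(A_1)^n$: the matrix $(a_{ij})$ with $a_{ii}=2$ and $a_{ij}=1-m_{ij}$ for $i\ne j$ is the Cartan matrix $\mathrm{diag}(2,\dots,2)$ of type $A_1\times\dots\times A_1$, where $m_{ij}$ is the least $k$ for which (1) holds for some $s_1,\dots,s_k\in R$ (equivalently, the least $m$ for which (2) holds for some $s'_1,\dots,s'_m\in R$). In other words, $m_{ij}=1$ for all $i\ne j$. Then $A$ is a simple ring if and only if the following three assertions hold: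 1. $R\sigma_i^d(t_i)+Rt_i=R$ for all $i\in\{1,\dots,n\}$ and all integers $d>0$; 2. $R$ is $\mathbb{Z}^n$-simple, i.e. $R\neq 0$ and the only ideals $J$ of $R$ with $\sigma_g(J)=J$ for all $g\in\mathbb{Z}^n$ are $0$ and $R$; 3. the center $Z(A)$ is contained in $R$. -/

import Mathlib

/-- A twisted generalized Weyl (TGW) datum `(R, σ, t, μ)` of rank `n`: an action `σ` of `ℤ^n` on the
commutative `k`-algebra `R` by `k`-algebra automorphisms, an `n`-tuple `t` of elements of `R`, and
an `n × n` matrix `μ` of invertible elements of `k` (its diagonal entries are never used). -/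
structure TGWDatum (k R : Type*) [CommRing k] [CommRing R] [Algebra k R] (n : ℕ) where
  σ : Multiplicative (Fin n → ℤ) →* (R ≃ₐ[k] R)
  t : Fin n → R
  μ : Matrix (Fin n) (Fin n) kˣ

/-- Generators of the twisted generalized Weyl construction: the elements of `R` and the `2n`
symbols `X i`, `Y i`. -/
inductive TGWGen (R : Type*) (n : ℕ) where
  | coeff (r : R) : TGWGen R n
  | X (i : Fin n) : TGWGen R n
  | Y (i : Fin n) : TGWGen R n

/-- The `ℤ^n`-degree of a generator: `deg r = 0`, `deg (X i) = e_i`, `deg (Y i) = -e_i`. -/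
def TGWGen.deg {R : Type*} {n : ℕ} : TGWGen R n → (Fin n → ℤ)
  | .coeff _ => 0
  | .X i => Pi.single i 1
  | .Y i => -Pi.single i 1

namespace TGWDatum

variable {k R : Type*} [CommRing k] [CommRing R] [Algebra k R] {n : ℕ}

/-- The automorphism `σ_i = σ_{e_i}` of `R`. -/
def sigma (D : TGWDatum k R n) (i : Fin n) : R ≃ₐ[k] R :=
  D.σ (Multiplicative.ofAdd (Pi.single i 1))

section Construction

/-- A generator, as an element of the free `k`-algebra on all generators. -/
abbrev fgen (k : Type*) {R : Type*} [CommRing k] {n : ℕ} (x : TGWGen R n) :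
    FreeAlgebra k (TGWGen R n) :=
  FreeAlgebra.ι k x

open TGWGen in
/-- The defining relations. The first four say that `r ↦ coeff r` is a homomorphism of
`k`-algebras, so that together they present the free ring over `R` on the symbols `X i`, `Y i`
in which `k` is central; the others are the relations of the twisted generalized Weyl
construction. (Centrality of `k` is no extra relation: it follows from `Xr` and `Yr`, as the
automorphisms `σ_i` fix the image of `k`.) -/
inductive Rel (D : TGWDatum k R n) :
    FreeAlgebra k (TGWGen R n) → FreeAlgebra k (TGWGen R n) → Prop
  | coeff_add (r s : R) :
      Rel D (fgen k (coeff (r + s))) (fgen k (coeff r) + fgen k (coeff s))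
  | coeff_mul (r s : R) :
      Rel D (fgen k (coeff (r * s))) (fgen k (coeff r) * fgen k (coeff s))
  | coeff_one : Rel D (fgen k (coeff 1)) 1
  | coeff_algebraMap (c : k) :
      Rel D (fgen k (coeff (algebraMap k R c))) (algebraMap k (FreeAlgebra k (TGWGen R n)) c)
  | Xr (i : Fin n) (r : R) :
      Rel D (fgen k (X i) * fgen k (coeff r)) (fgen k (coeff (D.sigma i r)) * fgen k (X i))
  | Yr (i : Fin n) (r : R) :
      Rel D (fgen k (Y i) * fgen k (coeff r)) (fgen k (coeff ((D.sigma i).symm r)) * fgen k (Y i))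
  | YX (i : Fin n) :
      Rel D (fgen k (Y i) * fgen k (X i)) (fgen k (coeff (D.t i)))
  | XY (i : Fin n) :
      Rel D (fgen k (X i) * fgen k (Y i)) (fgen k (coeff (D.sigma i (D.t i))))
  | XYμ (i j : Fin n) (h : i ≠ j) :
      Rel D (fgen k (X i) * fgen k (Y j)) ((D.μ i j : k) • (fgen k (Y j) * fgen k (X i)))

/-- The twisted generalized Weyl construction `A' = A'(R, σ, t, μ)`. -/
abbrev TGWC (D : TGWDatum k R n) : Type _ := RingQuot D.Rel

/-- The image of a generator in `A'`. -/
def gen' (D : TGWDatum k R n) (x : TGWGen R n) : D.TGWC :=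
  RingQuot.mkAlgHom k D.Rel (fgen k x)

/-- The canonical homomorphism `ι : R → A'`. -/
def iota (D : TGWDatum k R n) : R →ₐ[k] D.TGWC where
  toFun r := D.gen' (.coeff r)
  map_one' := by
    simpa [gen'] using RingQuot.mkAlgHom_rel k (Rel.coeff_one (D := D))
  map_mul' r s := by
    simpa [gen'] using RingQuot.mkAlgHom_rel k (Rel.coeff_mul (D := D) r s)
  map_zero' := by
    have h := RingQuot.mkAlgHom_rel k (Rel.coeff_algebraMap (D := D) 0)
    simpa [gen'] using h
  map_add' r s := by
    simpa [gen'] using RingQuot.mkAlgHom_rel k (Rel.coeff_add (D := D) r s)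
  commutes' c := by
    have h := RingQuot.mkAlgHom_rel k (Rel.coeff_algebraMap (D := D) c)
    rw [AlgHom.commutes] at h
    exact h

/-- The homogeneous component `A'_g` of `A'`: the span of all products of generators whose total
degree is `g`. -/
def component' (D : TGWDatum k R n) (g : Fin n → ℤ) : Submodule k D.TGWC :=
  Submodule.span k
    {a | ∃ w : List (TGWGen R n), (w.map TGWGen.deg).sum = g ∧ a = (w.map D.gen').prod}

/-- A two-sided ideal `J` of `A'` is graded if `J = ∑_g (J ∩ A'_g)`. -/
def IsGradedIdeal (D : TGWDatum k R n) (J : TwoSidedIdeal D.TGWC) : Prop :=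
  ∀ a ∈ J, a ∈ AddSubgroup.closure {b | b ∈ J ∧ ∃ g, b ∈ D.component' g}

/-- The gradical of `A'`: the sum of all graded ideals `J` of `A'` with `A'_0 ∩ J = 0`. -/
def gradical (D : TGWDatum k R n) : TwoSidedIdeal D.TGWC :=
  sSup {J | D.IsGradedIdeal J ∧ ∀ a ∈ J, a ∈ D.component' 0 → a = 0}

/-- The twisted generalized Weyl algebra `A = A(R, σ, t, μ)`, the quotient of `A'` by its
gradical. -/
abbrev TGWA (D : TGWDatum k R n) : Type _ := D.gradical.ringCon.Quotient

/-- The projection `A' → A`. -/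
def proj (D : TGWDatum k R n) : D.TGWC →ₐ[k] D.TGWA := D.gradical.ringCon.mkₐ k

/-- The canonical homomorphism `R → A`, whose range is the copy of `R` in `A`. -/
def ofCoeff (D : TGWDatum k R n) : R →ₐ[k] D.TGWA := D.proj.comp D.iota

/-- The homogeneous component `A_g` of `A`, the image of `A'_g`. -/
def component (D : TGWDatum k R n) (g : Fin n → ℤ) : Submodule k D.TGWA :=
  (D.component' g).map D.proj.toLinearMap

end Construction

/-- `A` is regularly graded: every homogeneous component contains an element that is neither a left
nor a right zero divisor in `A`. -/
def IsRegularlyGraded (D : TGWDatum k R n) : Prop :=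
  ∀ g : Fin n → ℤ, ∃ a ∈ D.component g, IsRegular a

/-- `σ_i^m(t_j) + s_1 σ_i^{m-1}(t_j) + ⋯ + s_m t_j = 0` for some `s_1, …, s_m ∈ R`. -/
def LeftRelation (D : TGWDatum k R n) (i j : Fin n) (m : ℕ) : Prop :=
  ∃ s : ℕ → R,
    (D.sigma i ^ m) (D.t j) + ∑ l ∈ Finset.Icc 1 m, s l * (D.sigma i ^ (m - l)) (D.t j) = 0

/-- `t_j + s_1 σ_i(t_j) + ⋯ + s_m σ_i^m(t_j) = 0` for some `s_1, …, s_m ∈ R`. -/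
def RightRelation (D : TGWDatum k R n) (i j : Fin n) (m : ℕ) : Prop :=
  ∃ s : ℕ → R, D.t j + ∑ l ∈ Finset.Icc 1 m, s l * (D.sigma i ^ l) (D.t j) = 0

/-- The datum is `R`-finitistic, that is, both left and right `R`-finitistic. -/
def IsFinitistic (D : TGWDatum k R n) : Prop :=
  (∀ i j : Fin n, i ≠ j → ∃ m : ℕ, D.LeftRelation i j m) ∧
    ∀ i j : Fin n, i ≠ j → ∃ m : ℕ, D.RightRelation i j m

/-- The number `m_{ij}`: the least length of a left relation. For an `R`-finitistic datum and
`i ≠ j` it is also the least length of a right relation. -/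
noncomputable def mij (D : TGWDatum k R n) (i j : Fin n) : ℕ :=
  sInf {m | D.LeftRelation i j m}

/-- The matrix associated with an `R`-finitistic datum. -/
noncomputable def cartanMatrix (D : TGWDatum k R n) : Matrix (Fin n) (Fin n) ℤ :=
  Matrix.of fun i j => if i = j then 2 else 1 - (D.mij i j : ℤ)

/-- The associated matrix is the Cartan matrix of type `A_1 × ⋯ × A_1` (`n` factors). -/
def IsLieTypeA1 (D : TGWDatum k R n) : Prop :=
  D.cartanMatrix = Matrix.diagonal fun _ => 2

/-- `R` is `ℤ^n`-simple: it is nonzero, and its only `ℤ^n`-invariant ideals are `0` and `R`. -/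
def IsZnSimple (D : TGWDatum k R n) : Prop :=
  Nontrivial R ∧ ∀ I : Ideal R, (∀ g, I.map (D.σ g) = I) → I = ⊥ ∨ I = ⊤

end TGWDatum

/-!
# Simplicity of twisted generalized Weyl algebras of type `A_1 × ⋯ × A_1`

The grading of `A'` is encoded by a homomorphism `A' → B[ℤ^n]` (`coaction'`). The gradical lies in
its kernel for `B = A`, so `A` inherits the grading, and the degree `0` component shows that the
gradical meets `R` trivially, so that `R` embeds into `A`.

The relations with the `μ_{ij}` reduce every word to a multiple of some `Y_u X_v` with `u` and `v`
disjoint (`exists_reduced_word`). Hence `A_0 = R` and `A_{±e_i}` is generated by `X_i` or `Y_i`;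
since `A` is regularly graded, `X_i`, `Y_i` and `t_i` are regular. In type `A_1 × ⋯ × A_1` the
element `t_j` is then an eigenvector of `σ_i` (`i ≠ j`) with an invertible eigenvalue, and comparing
products in degree `0` shows that the `X_i`, and likewise the `Y_i`, commute up to units of `R`. So
powers of `X_i` and `Y_i` can be split off on either side of homogeneous elements.

*Necessity.* For an ideal `J` of `R` the elements of `A` all of whose two-sided multiples have
degree `0` component in `J` form a two-sided ideal `core J`, which is proper if `J` is, and so is
zero if `A` is simple. It contains `J` if `J` is invariant, which gives `ℤ^n`-simplicity, and it
contains `X_i^d ≠ 0` if `J` is generated by `t_i` and `σ_i^d(t_i)`, which gives comaximality. The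
center of `A` is a graded field, hence concentrated in degree `0` (`comp_eq_zero_of_comm`).

*Sufficiency.* If a two-sided ideal `K` meets `R`, then `ℤ^n`-simplicity puts a monomial in the
`X_i` into `K`, and comaximality lowers its degree step by step to `1`
(`Admissible.exists_xs_mem`, `Admissible.one_mem_of_xs_mem`). For an arbitrary ideal `J ≠ 0` this is
applied to `leadingIdeal`, built from an element of minimal support: `J` then contains an element of
minimal support whose component in degree `0` is `1`. It commutes with all homogeneous elements, by
minimality, so it is central, lies in `R` and equals `1`.
-/

namespace TGWDatum

variable {k R : Type*} [CommRing k] [CommRing R] [Algebra k R] {n : ℕ} (D : TGWDatum k R n)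

/-! ### Words and the coaction -/

/-- The image of a generator in `A`. -/
def gen (x : TGWGen R n) : D.TGWA := D.proj (D.gen' x)

lemma gen_def : D.gen = D.proj ∘ D.gen' := rfl

lemma proj_surjective : Function.Surjective D.proj := Quotient.mk_surjective

lemma proj_eq_zero_iff (a : D.TGWC) : D.proj a = 0 ↔ a ∈ D.gradical := by
  rw [TwoSidedIdeal.mem_iff, ← map_zero D.proj]
  exact RingCon.eq _

lemma gen'_adjoin : Algebra.adjoin k (Set.range D.gen') = ⊤ := by
  have h : Set.range D.gen' = RingQuot.mkAlgHom k D.Rel '' Set.range (FreeAlgebra.ι k) := by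
    rw [← Set.range_comp]; rfl
  rw [h, ← AlgHom.map_adjoin, FreeAlgebra.adjoin_range_ι, Algebra.map_top,
    AlgHom.range_eq_top]
  exact RingQuot.mkAlgHom_surjective k _

/-- `A'` is spanned over `k` by the words in the generators. -/
lemma span_words' : Submodule.span k (Set.range fun w : List (TGWGen R n) => (w.map D.gen').prod)
    = ⊤ := by
  rw [eq_top_iff, ← Algebra.top_toSubmodule, ← D.gen'_adjoin, Algebra.adjoin_eq_span]
  refine Submodule.span_mono fun a ha => ?_
  obtain ⟨l, hl, rfl⟩ := Submonoid.exists_list_of_mem_closure ha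
  obtain ⟨w, rfl⟩ : l ∈ Set.range (List.map D.gen') := by
    rw [Set.range_list_map]; exact hl
  exact ⟨w, rfl⟩

section Coaction

variable {B : Type*} [Ring B] [Algebra k B] (f : D.TGWC →ₐ[k] B)

open AddMonoidAlgebra in
/-- The homomorphism `A' → B[ℤ^n]` that sends a generator `x` to `f x` placed in degree `deg x`.
It encodes the grading of `A'`: the coefficients of the image of `a` are the images under `f` of the
homogeneous components of `a`. -/
noncomputable def coaction' : D.TGWC →ₐ[k] AddMonoidAlgebra B (Fin n → ℤ) :=
  RingQuot.liftAlgHom k ⟨FreeAlgebra.lift k fun x => single x.deg (f (D.gen' x)), by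
    have key : ∀ {a b}, D.Rel a b → f (RingQuot.mkAlgHom k D.Rel a) =
        f (RingQuot.mkAlgHom k D.Rel b) := fun h => by rw [RingQuot.mkAlgHom_rel k h]
    intro a b h
    have h' := key h
    induction h with
    | coeff_add r s =>
      simp only [map_add, FreeAlgebra.lift_ι_apply, TGWGen.deg, ← single_add] at h' ⊢
      exact congrArg _ h'
    | coeff_mul r s =>
      simp only [map_mul, FreeAlgebra.lift_ι_apply, TGWGen.deg, single_mul_single, add_zero] at h' ⊢
      exact congrArg _ h'
    | coeff_one =>
      simp only [map_one, FreeAlgebra.lift_ι_apply, TGWGen.deg] at h' ⊢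
      exact congrArg _ h'
    | coeff_algebraMap c =>
      simp only [AlgHom.commutes, FreeAlgebra.lift_ι_apply, TGWGen.deg] at h' ⊢
      exact congrArg _ h'
    | Xr i r =>
      simp only [map_mul, FreeAlgebra.lift_ι_apply, TGWGen.deg, single_mul_single, add_zero,
        zero_add] at h' ⊢
      exact congrArg _ h'
    | Yr i r =>
      simp only [map_mul, FreeAlgebra.lift_ι_apply, TGWGen.deg, single_mul_single, add_zero,
        zero_add] at h' ⊢
      exact congrArg _ h'
    | YX i =>
      simp only [map_mul, FreeAlgebra.lift_ι_apply, TGWGen.deg, single_mul_single,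
        neg_add_cancel] at h' ⊢
      exact congrArg _ h'
    | XY i =>
      simp only [map_mul, FreeAlgebra.lift_ι_apply, TGWGen.deg, single_mul_single,
        add_neg_cancel] at h' ⊢
      exact congrArg _ h'
    | XYμ i j hij =>
      simp only [map_mul, map_smul, FreeAlgebra.lift_ι_apply, TGWGen.deg, single_mul_single,
        smul_single, neg_add_eq_sub, ← sub_eq_add_neg] at h' ⊢
      exact congrArg _ h'⟩

lemma coaction'_word (w : List (TGWGen R n)) :
    D.coaction' f (w.map D.gen').prod =
      .single (w.map TGWGen.deg).sum (f (w.map D.gen').prod) := by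
  induction w with
  | nil => simp [AddMonoidAlgebra.one_def]
  | cons x w ih =>
    have hx : D.coaction' f (D.gen' x) = .single x.deg (f (D.gen' x)) := by
      simp [coaction', gen']
    simp [ih, hx, AddMonoidAlgebra.single_mul_single]

lemma coaction'_of_mem {g : Fin n → ℤ} {a : D.TGWC} (ha : a ∈ D.component' g) :
    D.coaction' f a = .single g (f a) := by
  induction ha using Submodule.span_induction with
  | mem a h => obtain ⟨w, rfl, rfl⟩ := h; exact D.coaction'_word f w
  | zero => simp
  | add a b _ _ ha hb => simp [ha, hb, AddMonoidAlgebra.single_add]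
  | smul c a _ ha => simp [ha, AddMonoidAlgebra.smul_single]

end Coaction

/-- The gradical is graded, so the grading of `A'` descends to `A`. -/
lemma gradical_le_ker : D.gradical ≤ TwoSidedIdeal.ker (D.coaction' D.proj) := by
  refine sSup_le fun J hJ a ha => (TwoSidedIdeal.mem_ker _).2 ?_
  have h := hJ.1 a ha
  clear ha
  induction h using AddSubgroup.closure_induction with
  | mem b hb =>
    obtain ⟨hb, g, hg⟩ := hb
    rw [D.coaction'_of_mem _ hg, (D.proj_eq_zero_iff b).2 (le_sSup hJ hb),
      AddMonoidAlgebra.single_zero]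
  | zero => simp
  | add a b _ _ ha hb => simp [ha, hb]
  | neg a _ ha => simp [ha]

/-- The elements of `A'` all of whose two-sided multiples have zero component in degree `0`;
an upper bound of the gradical. -/
def gradicalBound : TwoSidedIdeal D.TGWC :=
  .mk' {a | ∀ b c, (D.coaction' (AlgHom.id k _) (b * a * c)).coeff 0 = 0}
    (by simp)
    (fun ha hb b c => by
      rw [mul_add, add_mul, map_add, AddMonoidAlgebra.coeff_add, Finsupp.add_apply, ha b c, hb b c,
        add_zero])
    (fun {x} ha b c => by
      have e : b * -x * c = -(b * x * c) := (congrArg (· * c) (mul_neg b x)).trans (neg_mul _ _)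
      rw [e, map_neg, AddMonoidAlgebra.coeff_neg, Finsupp.neg_apply, ha b c,
        neg_zero])
    (fun {x y} hy b c => by simpa only [mul_assoc] using hy (b * x) c)
    (fun {x y} hx b c => by simpa only [mul_assoc] using hx b (y * c))

lemma gradical_le_gradicalBound : D.gradical ≤ D.gradicalBound := by
  refine sSup_le fun J hJ a ha => ?_
  rw [gradicalBound, TwoSidedIdeal.mem_mk']
  intro b c
  have h := hJ.1 _ (J.mul_mem_right _ c (J.mul_mem_left b _ ha))
  generalize b * a * c = x at h
  induction h using AddSubgroup.closure_induction with
  | mem b hb =>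
    obtain ⟨hb, g, hg⟩ := hb
    rw [D.coaction'_of_mem _ hg, AddMonoidAlgebra.coeff_single, Finsupp.single_apply]
    split_ifs with h
    · subst h; exact hJ.2 b hb hg
    · rfl
  | zero => simp
  | add a b _ _ ha hb => simp [ha, hb]
  | neg a _ ha => simp [ha]

lemma iota_mem (r : R) : D.iota r ∈ D.component' 0 :=
  Submodule.subset_span ⟨[.coeff r], by simp [TGWGen.deg],
    (List.prod_singleton (x := D.gen' (.coeff r))).symm⟩

/-- `R` embeds into `A`, because the gradical meets `A'_0` trivially. -/
lemma ofCoeff_injective (hinj : Function.Injective D.iota) : Function.Injective D.ofCoeff := by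
  rw [injective_iff_map_eq_zero]
  intro r hr
  have h := D.gradical_le_gradicalBound ((D.proj_eq_zero_iff _).1 hr)
  rw [gradicalBound, TwoSidedIdeal.mem_mk'] at h
  have h1 := h 1 1
  change (D.coaction' (AlgHom.id k _) (1 * D.iota r * 1)).coeff 0 = 0 at h1
  rw [one_mul, mul_one, D.coaction'_of_mem _ (D.iota_mem r)] at h1
  exact (injective_iff_map_eq_zero D.iota).1 hinj r (by simpa using h1)

/-- The homomorphism `A → A[ℤ^n]` which spreads an element over its homogeneous components. -/
noncomputable def coaction : D.TGWA →+* AddMonoidAlgebra D.TGWA (Fin n → ℤ) :=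
  D.gradical.ringCon.lift (D.coaction' D.proj : D.TGWC →+* _) fun {a b} h => by
    have h1 := D.gradical_le_ker ((D.gradical.rel_iff a b).1 h)
    rw [TwoSidedIdeal.mem_ker, map_sub, sub_eq_zero] at h1
    exact h1

lemma coaction_of_mem {g : Fin n → ℤ} {a : D.TGWA} (ha : a ∈ D.component g) :
    D.coaction a = .single g a := by
  obtain ⟨a, ha, rfl⟩ := ha
  exact D.coaction'_of_mem D.proj ha

/-- The homogeneous component of degree `g` of an element of `A`. -/
noncomputable def comp (g : Fin n → ℤ) : D.TGWA →+ D.TGWA where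
  toFun a := (D.coaction a).coeff g
  map_zero' := by simp
  map_add' a b := by simp

lemma comp_apply (g : Fin n → ℤ) (a : D.TGWA) : D.comp g a = (D.coaction a).coeff g := rfl

lemma component_eq_span (g : Fin n → ℤ) : D.component g =
    Submodule.span k {a | ∃ w : List (TGWGen R n),
      (w.map TGWGen.deg).sum = g ∧ a = (w.map D.gen).prod} := by
  rw [component, component', Submodule.map_span]
  congr 1
  ext a
  constructor
  · rintro ⟨_, ⟨w, hw, rfl⟩, rfl⟩
    exact ⟨w, hw, by simp [map_list_prod, gen_def]⟩
  · rintro ⟨w, hw, rfl⟩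
    exact ⟨_, ⟨w, hw, rfl⟩, by simp [map_list_prod, gen_def]⟩

lemma word_mem (w : List (TGWGen R n)) :
    (w.map D.gen).prod ∈ D.component (w.map TGWGen.deg).sum := by
  rw [component_eq_span]
  exact Submodule.subset_span ⟨w, rfl, rfl⟩

lemma span_words : Submodule.span k (Set.range fun w : List (TGWGen R n) => (w.map D.gen).prod)
    = ⊤ := by
  have h := congrArg (Submodule.map D.proj.toLinearMap) D.span_words'
  rw [Submodule.map_span, ← Set.range_comp, Submodule.map_top,
    LinearMap.range_eq_top.2 D.proj_surjective] at h
  rw [← h]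
  congr 1
  ext a
  simp [map_list_prod, gen_def]

/-- Induction principle: an additive property holds for all of `A` once it holds for homogeneous
elements. -/
lemma homogeneous_induction {P : D.TGWA → Prop} (hom : ∀ g, ∀ a ∈ D.component g, P a)
    (add : ∀ a b, P a → P b → P (a + b)) (a : D.TGWA) : P a := by
  have ha : a ∈ ⨆ g, D.component g := by
    have h : ⊤ ≤ ⨆ g, D.component g := by
      rw [← D.span_words, Submodule.span_le]
      rintro _ ⟨w, rfl⟩
      exact Submodule.mem_iSup_of_mem _ (D.word_mem w)
    exact h trivial
  exact Submodule.iSup_induction (motive := P) _ ha hom (hom 0 0 (Submodule.zero_mem _)) add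

lemma comp_of_mem {g : Fin n → ℤ} {a : D.TGWA} (ha : a ∈ D.component g) (h : Fin n → ℤ) :
    D.comp h a = if g = h then a else 0 := by
  rw [comp_apply, D.coaction_of_mem ha, AddMonoidAlgebra.coeff_single, Finsupp.single_apply]

lemma comp_mem (g : Fin n → ℤ) (a : D.TGWA) : D.comp g a ∈ D.component g := by
  induction a using D.homogeneous_induction with
  | hom h a ha =>
    rw [D.comp_of_mem ha]
    split_ifs with e
    · exact e ▸ ha
    · exact Submodule.zero_mem _
  | add a b ha hb => rw [map_add]; exact Submodule.add_mem _ ha hb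

lemma mul_mem_component {g h : Fin n → ℤ} {a b : D.TGWA} (ha : a ∈ D.component g)
    (hb : b ∈ D.component h) : a * b ∈ D.component (g + h) := by
  have e : D.comp (g + h) (a * b) = a * b := by
    rw [comp_apply, map_mul, D.coaction_of_mem ha, D.coaction_of_mem hb,
      AddMonoidAlgebra.single_mul_single, AddMonoidAlgebra.coeff_single, Finsupp.single_eq_same]
  exact e ▸ D.comp_mem _ _

lemma comp_mul_left {g : Fin n → ℤ} {a : D.TGWA} (ha : a ∈ D.component g) (h : Fin n → ℤ)
    (b : D.TGWA) : D.comp h (a * b) = a * D.comp (h - g) b := by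
  rw [comp_apply, comp_apply, map_mul, D.coaction_of_mem ha,
    AddMonoidAlgebra.coeff_single_mul_apply, neg_add_eq_sub]

lemma comp_mul_right {g : Fin n → ℤ} {a : D.TGWA} (ha : a ∈ D.component g) (h : Fin n → ℤ)
    (b : D.TGWA) : D.comp h (b * a) = D.comp (h - g) b * a := by
  rw [comp_apply, comp_apply, map_mul, D.coaction_of_mem ha,
    AddMonoidAlgebra.coeff_mul_single_apply, sub_eq_add_neg]

/-- The set of degrees in which an element of `A` has a nonzero component. -/
noncomputable def supp (a : D.TGWA) : Finset (Fin n → ℤ) := (D.coaction a).coeff.support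

lemma mem_supp {a : D.TGWA} {g : Fin n → ℤ} : g ∈ D.supp a ↔ D.comp g a ≠ 0 := by
  rw [supp, Finsupp.mem_support_iff, comp_apply]

lemma sum_comp (a : D.TGWA) : ∑ g ∈ D.supp a, D.comp g a = a := by
  have h : (D.coaction a).coeff.sum (fun _ b => b) = a := by
    induction a using D.homogeneous_induction with
    | hom g a ha => simp [D.coaction_of_mem ha]
    | add a b ha hb =>
      rw [map_add, AddMonoidAlgebra.coeff_add, Finsupp.sum_add_index' (by simp) (by simp), ha, hb]
  exact h

lemma eq_of_comp_eq {a b : D.TGWA} (h : ∀ g, D.comp g a = D.comp g b) : a = b := by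
  have e : D.coaction a = D.coaction b := AddMonoidAlgebra.ext (Finsupp.ext h)
  rw [← D.sum_comp a, ← D.sum_comp b, supp, supp, e]
  exact Finset.sum_congr rfl fun g _ => h g

end TGWDatum

namespace TGWDatum

variable {k R : Type*} [CommRing k] [CommRing R] [Algebra k R] {n : ℕ} (D : TGWDatum k R n)

/-! ### Relations in `A` and commutation up to units of `R` -/

/-- The automorphism `σ_g` of `R`, with `g` written additively. -/
def act (g : Fin n → ℤ) : R ≃ₐ[k] R := D.σ (Multiplicative.ofAdd g)

@[simp] lemma act_zero (r : R) : D.act 0 r = r := by simp [act]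

lemma act_add (g h : Fin n → ℤ) (r : R) : D.act (g + h) r = D.act g (D.act h r) := by
  simp [act, ofAdd_add]

lemma act_comm (g h : Fin n → ℤ) (r : R) : D.act g (D.act h r) = D.act h (D.act g r) := by
  rw [← act_add, ← act_add, add_comm]

lemma act_single (i : Fin n) : D.act (Pi.single i 1) = D.sigma i := rfl

lemma act_neg_single (i : Fin n) (r : R) : D.act (-Pi.single i 1) r = (D.sigma i).symm r := by
  rw [AlgEquiv.eq_symm_apply, ← act_single, ← act_add, add_neg_cancel, act_zero]

lemma act_neg_act (g : Fin n → ℤ) (r : R) : D.act (-g) (D.act g r) = r := by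
  rw [← act_add, neg_add_cancel, act_zero]

lemma act_act_neg (g : Fin n → ℤ) (r : R) : D.act g (D.act (-g) r) = r := by
  rw [← act_add, add_neg_cancel, act_zero]

lemma act_nsmul_single (i : Fin n) (d : ℕ) (r : R) :
    D.act (d • Pi.single i 1) r = (D.sigma i ^ d) r := by
  induction d generalizing r with
  | zero => simp
  | succ d ih => rw [succ_nsmul, act_add, ih, pow_succ, act_single]; rfl

/-- The element `X_i` of `A`. -/
def x (i : Fin n) : D.TGWA := D.gen (.X i)

/-- The element `Y_i` of `A`. -/
def y (i : Fin n) : D.TGWA := D.gen (.Y i)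

lemma gen_coeff (r : R) : D.gen (.coeff r) = D.ofCoeff r := rfl

lemma rel_map {a b : FreeAlgebra k (TGWGen R n)} (h : D.Rel a b) :
    D.proj (RingQuot.mkAlgHom k D.Rel a) = D.proj (RingQuot.mkAlgHom k D.Rel b) := by
  rw [RingQuot.mkAlgHom_rel k h]

lemma x_mul_ofCoeff (i : Fin n) (r : R) :
    D.x i * D.ofCoeff r = D.ofCoeff (D.sigma i r) * D.x i := by
  have h := D.rel_map (.Xr i r)
  simp only [map_mul] at h
  exact h

lemma y_mul_ofCoeff (i : Fin n) (r : R) :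
    D.y i * D.ofCoeff r = D.ofCoeff ((D.sigma i).symm r) * D.y i := by
  have h := D.rel_map (.Yr i r)
  simp only [map_mul] at h
  exact h

lemma y_mul_x (i : Fin n) : D.y i * D.x i = D.ofCoeff (D.t i) := by
  have h := D.rel_map (.YX i)
  simp only [map_mul] at h
  exact h

lemma x_mul_y (i : Fin n) : D.x i * D.y i = D.ofCoeff (D.sigma i (D.t i)) := by
  have h := D.rel_map (.XY i)
  simp only [map_mul] at h
  exact h

lemma x_mul_y_of_ne {i j : Fin n} (hij : i ≠ j) :
    D.x i * D.y j = D.ofCoeff (algebraMap k R (D.μ i j)) * (D.y j * D.x i) := by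
  have h := D.rel_map (.XYμ i j hij)
  simp only [map_mul, map_smul] at h
  rw [AlgHom.commutes, ← Algebra.smul_def]
  exact h

lemma gen_mem (a : TGWGen R n) : D.gen a ∈ D.component a.deg := by
  have := D.word_mem [a]
  rwa [List.map_singleton, List.map_singleton, List.prod_singleton, List.sum_singleton] at this

lemma ofCoeff_mem (r : R) : D.ofCoeff r ∈ D.component 0 := D.gen_mem (.coeff r)

lemma x_mem (i : Fin n) : D.x i ∈ D.component (Pi.single i 1) := D.gen_mem (.X i)

lemma y_mem (i : Fin n) : D.y i ∈ D.component (-Pi.single i 1) := D.gen_mem (.Y i)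

lemma one_mem_component : (1 : D.TGWA) ∈ D.component 0 := by
  simpa using D.ofCoeff_mem 1

lemma gen_mul_ofCoeff (a : TGWGen R n) (r : R) :
    D.gen a * D.ofCoeff r = D.ofCoeff (D.act a.deg r) * D.gen a := by
  cases a with
  | coeff s => rw [gen_coeff, TGWGen.deg, act_zero, ← map_mul, ← map_mul, mul_comm]
  | X i => exact D.x_mul_ofCoeff i r
  | Y i => rw [TGWGen.deg, act_neg_single]; exact D.y_mul_ofCoeff i r

/-- Homogeneous elements of degree `g` normalise `R` through `σ_g`. -/
lemma mul_ofCoeff_of_mem {g : Fin n → ℤ} {a : D.TGWA} (ha : a ∈ D.component g) (r : R) :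
    a * D.ofCoeff r = D.ofCoeff (D.act g r) * a := by
  rw [component_eq_span] at ha
  induction ha using Submodule.span_induction with
  | mem a h =>
    obtain ⟨w, rfl, rfl⟩ := h
    induction w generalizing r with
    | nil => simp
    | cons a w ih =>
      rw [List.map_cons, List.map_cons, List.prod_cons, List.sum_cons, mul_assoc, ih, ← mul_assoc,
        gen_mul_ofCoeff, mul_assoc, act_add]
  | zero => simp
  | add a b _ _ ha hb => rw [add_mul, ha, hb, mul_add]
  | smul c a _ ha => rw [smul_mul_assoc, ha, mul_smul_comm]

lemma ofCoeff_mul_of_mem {g : Fin n → ℤ} {a : D.TGWA} (ha : a ∈ D.component g) (r : R) :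
    D.ofCoeff r * a = a * D.ofCoeff (D.act (-g) r) := by
  rw [D.mul_ofCoeff_of_mem ha, act_act_neg]

/-- Two elements of `A` are associated if they differ by a unit of `R`, acting from the left. -/
def Assoc (a b : D.TGWA) : Prop := ∃ u : Rˣ, a = D.ofCoeff u * b

variable {D}

lemma Assoc.refl (a : D.TGWA) : D.Assoc a a := ⟨1, by simp⟩

lemma Assoc.symm {a b : D.TGWA} (h : D.Assoc a b) : D.Assoc b a := by
  obtain ⟨u, rfl⟩ := h
  exact ⟨u⁻¹, by rw [← mul_assoc, ← map_mul, Units.inv_mul, map_one, one_mul]⟩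

lemma Assoc.trans {a b c : D.TGWA} (h : D.Assoc a b) (h' : D.Assoc b c) : D.Assoc a c := by
  obtain ⟨u, rfl⟩ := h
  obtain ⟨v, rfl⟩ := h'
  exact ⟨u * v, by rw [← mul_assoc, ← map_mul, Units.val_mul]⟩

lemma Assoc.mul_right {a b : D.TGWA} (h : D.Assoc a b) (c : D.TGWA) : D.Assoc (a * c) (b * c) := by
  obtain ⟨u, rfl⟩ := h
  exact ⟨u, mul_assoc _ _ _⟩

lemma Assoc.mul_left {g : Fin n → ℤ} {c : D.TGWA} (hc : c ∈ D.component g) {a b : D.TGWA}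
    (h : D.Assoc a b) : D.Assoc (c * a) (c * b) := by
  obtain ⟨u, rfl⟩ := h
  exact ⟨Units.map (D.act g : R →* R) u, by
    rw [← mul_assoc, D.mul_ofCoeff_of_mem hc, mul_assoc]; rfl⟩

lemma Assoc.mem_iff {J : TwoSidedIdeal D.TGWA} {a b : D.TGWA} (h : D.Assoc a b) :
    a ∈ J ↔ b ∈ J := by
  constructor
  · intro ha
    obtain ⟨u, rfl⟩ := h.symm
    exact J.mul_mem_left _ _ ha
  · intro hb
    obtain ⟨u, rfl⟩ := h
    exact J.mul_mem_left _ _ hb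

variable (D)

/-- The product of the `X_i`, `i` running over the list `v`. -/
def xs (v : List (Fin n)) : D.TGWA := (v.map D.x).prod

/-- The product of the `Y_i`, `i` running over the list `u`. -/
def ys (u : List (Fin n)) : D.TGWA := (u.map D.y).prod

@[simp] lemma xs_nil : D.xs [] = 1 := rfl
@[simp] lemma ys_nil : D.ys [] = 1 := rfl
lemma xs_cons (i : Fin n) (v : List (Fin n)) : D.xs (i :: v) = D.x i * D.xs v := List.prod_cons
lemma ys_cons (i : Fin n) (v : List (Fin n)) : D.ys (i :: v) = D.y i * D.ys v := List.prod_cons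
lemma xs_append (v w : List (Fin n)) : D.xs (v ++ w) = D.xs v * D.xs w := by simp [xs]
lemma ys_append (v w : List (Fin n)) : D.ys (v ++ w) = D.ys v * D.ys w := by simp [ys]
lemma xs_replicate (m : ℕ) (i : Fin n) : D.xs (.replicate m i) = D.x i ^ m := by simp [xs]
lemma ys_replicate (m : ℕ) (i : Fin n) : D.ys (.replicate m i) = D.y i ^ m := by simp [ys]

/-- The vector counting how often each index occurs in a list. -/
def countVec (v : List (Fin n)) : Fin n → ℤ := fun j => (v.count j : ℤ)

@[simp] lemma countVec_apply (v : List (Fin n)) (j : Fin n) : countVec v j = v.count j := rfl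

@[simp] lemma countVec_nil : countVec ([] : List (Fin n)) = 0 := by ext; simp

lemma countVec_cons (i : Fin n) (v : List (Fin n)) :
    countVec (i :: v) = Pi.single i 1 + countVec v := by
  ext j
  by_cases h : i = j
  · subst h; simp [add_comm]
  · simp [List.count_cons_of_ne h, Pi.single_eq_of_ne' h]

lemma xs_mem (v : List (Fin n)) : D.xs v ∈ D.component (countVec v) := by
  induction v with
  | nil => simpa using D.one_mem_component
  | cons i v ih => rw [xs_cons, countVec_cons]; exact D.mul_mem_component (D.x_mem i) ih

lemma x_pow_mem (i : Fin n) (d : ℕ) : D.x i ^ d ∈ D.component (d • Pi.single i 1) := by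
  rw [← xs_replicate]
  convert D.xs_mem (List.replicate d i) using 2
  ext j
  by_cases e : i = j
  · subst e; simp
  · simp [e, List.count_replicate]

lemma ys_mem (u : List (Fin n)) : D.ys u ∈ D.component (-countVec u) := by
  induction u with
  | nil => simpa using D.one_mem_component
  | cons i v ih => rw [ys_cons, countVec_cons, neg_add]; exact D.mul_mem_component (D.y_mem i) ih

variable {D}

lemma assoc_x_y {i j : Fin n} (hij : i ≠ j) : D.Assoc (D.x i * D.y j) (D.y j * D.x i) :=
  ⟨Units.map (algebraMap k R : k →* R) (D.μ i j), D.x_mul_y_of_ne hij⟩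

lemma assoc_xs_y {v : List (Fin n)} {j : Fin n} (h : j ∉ v) :
    D.Assoc (D.xs v * D.y j) (D.y j * D.xs v) := by
  induction v with
  | nil => simpa using Assoc.refl _
  | cons i v ih =>
    rw [List.mem_cons, not_or] at h
    rw [xs_cons, mul_assoc]
    refine ((ih h.2).mul_left (D.x_mem i)).trans ?_
    rw [← mul_assoc, ← mul_assoc]
    exact (assoc_x_y (Ne.symm h.1)).mul_right _

lemma assoc_xs_ys {u v : List (Fin n)} (h : u.Disjoint v) :
    D.Assoc (D.xs v * D.ys u) (D.ys u * D.xs v) := by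
  induction u with
  | nil => simpa using Assoc.refl _
  | cons i u ih =>
    rw [List.disjoint_cons_left] at h
    rw [ys_cons, ← mul_assoc]
    refine ((assoc_xs_y h.1).mul_right _).trans ?_
    rw [mul_assoc, mul_assoc]
    exact (ih h.2).mul_left (D.y_mem i)

lemma assoc_x_ys {u : List (Fin n)} {i : Fin n} (h : i ∉ u) :
    D.Assoc (D.x i * D.ys u) (D.ys u * D.x i) := by
  have := assoc_xs_ys (D := D) (u := u) (v := [i]) (by simpa using h)
  simpa [xs_cons] using this

/-- `X_i` multiplies a word `Y_u` containing `i` into `R` times the word with one letter `i`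
removed. -/
lemma x_mul_ys (u₁ u₂ : List (Fin n)) (i : Fin n) (h : i ∉ u₁) :
    ∃ r, D.x i * D.ys (u₁ ++ i :: u₂) = D.ofCoeff r * D.ys (u₁ ++ u₂) := by
  obtain ⟨u, hu⟩ := assoc_x_ys (D := D) h
  refine ⟨u * D.act (-countVec u₁) (D.sigma i (D.t i)), ?_⟩
  rw [ys_append, ys_append, ys_cons, ← mul_assoc, hu, map_mul]
  simp only [mul_assoc]
  rw [← mul_assoc (D.x i), x_mul_y, ← mul_assoc (D.ys u₁), D.mul_ofCoeff_of_mem (D.ys_mem u₁)]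
  simp only [mul_assoc]

/-- `Y_i` multiplies a reduced word `Y_u X_v` with `i` in `v` into `R` times the word with one
letter `i` removed from `v`. -/
lemma y_mul_ys_xs (u v₁ v₂ : List (Fin n)) (i : Fin n) (h : i ∉ v₁)
    (hd : u.Disjoint (v₁ ++ i :: v₂)) :
    ∃ r, D.y i * (D.ys u * D.xs (v₁ ++ i :: v₂)) = D.ofCoeff r * (D.ys u * D.xs (v₁ ++ v₂)) := by
  simp only [List.disjoint_append_right, List.disjoint_cons_right] at hd
  -- move the letters `v₁` to the left of `Y_u` and of `Y_i`, cancel `Y_i X_i`, and move them back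
  obtain ⟨e₁, h₁⟩ := (assoc_x_ys (D := D) hd.2.1).symm
  obtain ⟨e₂, h₂⟩ := (assoc_xs_y (D := D) h).symm
  obtain ⟨e₃, h₃⟩ := (assoc_xs_ys (D := D) hd.1).symm
  obtain ⟨e₄, h₄⟩ := assoc_xs_ys (D := D) hd.1
  have key : ∃ r, D.y i * (D.ys u * D.xs v₁ * D.x i) = D.ofCoeff r * (D.ys u * D.xs v₁) := by
    have hYX := D.mul_mem_component (D.y_mem i) (D.xs_mem v₁)
    refine ⟨(D.sigma i).symm e₃ * (D.act (-Pi.single i 1 + countVec v₁) e₁ *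
      (e₂ * (D.act (countVec v₁) (D.t i) * e₄))), ?_⟩
    conv_lhs => rw [h₃]
    calc D.y i * (D.ofCoeff e₃ * (D.xs v₁ * D.ys u) * D.x i)
        = (D.y i * D.ofCoeff e₃) * (D.xs v₁ * (D.ys u * D.x i)) := by simp only [mul_assoc]
      _ = D.ofCoeff ((D.sigma i).symm e₃) * (((D.y i * D.xs v₁) * D.ofCoeff e₁) *
            (D.x i * D.ys u)) := by
          rw [y_mul_ofCoeff, h₁]; simp only [mul_assoc]
      _ = D.ofCoeff ((D.sigma i).symm e₃) * (D.ofCoeff (D.act (-Pi.single i 1 + countVec v₁) e₁) *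
            (D.ofCoeff e₂ * ((D.xs v₁ * (D.y i * D.x i)) * D.ys u))) := by
          rw [D.mul_ofCoeff_of_mem hYX, h₂]; simp only [mul_assoc]
      _ = _ := by
          rw [y_mul_x, D.mul_ofCoeff_of_mem (D.xs_mem v₁)]
          simp only [map_mul, mul_assoc]
          rw [h₄]
  obtain ⟨r, hr⟩ := key
  refine ⟨r, ?_⟩
  rw [xs_append, xs_append, xs_cons]
  calc D.y i * (D.ys u * (D.xs v₁ * (D.x i * D.xs v₂)))
      = D.y i * (D.ys u * D.xs v₁ * D.x i) * D.xs v₂ := by simp only [mul_assoc]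
    _ = _ := by rw [hr]; simp only [mul_assoc]

/-- Every word in the generators is a multiple by `R` of a reduced word `Y_u X_v`, in which no index
occurs in both `u` and `v`. -/
lemma exists_reduced_word (w : List (TGWGen R n)) : ∃ r u v, List.Disjoint u v ∧
    countVec v - countVec u = (w.map TGWGen.deg).sum ∧
    (w.map D.gen).prod = D.ofCoeff r * (D.ys u * D.xs v) := by
  induction w with
  | nil => exact ⟨1, [], [], by simp⟩
  | cons a w ih =>
    obtain ⟨r, u, v, hd, hg, hw⟩ := ih
    suffices h : ∃ s u' v', List.Disjoint u' v' ∧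
        countVec v' - countVec u' = a.deg + (countVec v - countVec u) ∧
        D.gen a * (D.ys u * D.xs v) = D.ofCoeff s * (D.ys u' * D.xs v') by
      obtain ⟨s, u', v', hd', hg', h⟩ := h
      refine ⟨D.act a.deg r * s, u', v', hd', by simp [hg', hg], ?_⟩
      rw [List.map_cons, List.prod_cons, hw, ← mul_assoc, gen_mul_ofCoeff, mul_assoc, h, map_mul,
        mul_assoc]
    cases a with
    | coeff s => exact ⟨s, u, v, hd, by simp [TGWGen.deg], rfl⟩
    | X i =>
      by_cases hi : i ∈ u
      · obtain ⟨u₁, u₂, rfl, h₁⟩ := List.eq_append_cons_of_mem hi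
        obtain ⟨s, hs⟩ := x_mul_ys (D := D) u₁ u₂ i h₁
        refine ⟨s, u₁ ++ u₂, v, ?_, ?_, ?_⟩
        · simp only [List.disjoint_append_left, List.disjoint_cons_left] at hd ⊢
          exact ⟨hd.1, hd.2.2⟩
        · ext j
          by_cases e : i = j
          · subst e; simp [TGWGen.deg]; ring
          · simp [TGWGen.deg, List.count_cons_of_ne e, Pi.single_eq_of_ne' e]
        · rw [← mul_assoc, ← mul_assoc, ← hs]; rfl
      · obtain ⟨s, hs⟩ := assoc_x_ys (D := D) hi
        refine ⟨s, u, i :: v, ?_, ?_, ?_⟩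
        · exact List.disjoint_cons_right.2 ⟨hi, hd⟩
        · rw [countVec_cons, TGWGen.deg, add_sub_assoc]
        · change D.x i * _ = _
          rw [← mul_assoc, hs, xs_cons]
          simp only [mul_assoc]
    | Y i =>
      by_cases hi : i ∈ v
      · obtain ⟨v₁, v₂, rfl, h₁⟩ := List.eq_append_cons_of_mem hi
        obtain ⟨s, hs⟩ := y_mul_ys_xs (D := D) u v₁ v₂ i h₁ hd
        refine ⟨s, u, v₁ ++ v₂, ?_, ?_, hs⟩
        · simp only [List.disjoint_append_right, List.disjoint_cons_right] at hd ⊢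
          exact ⟨hd.1, hd.2.2⟩
        · ext j
          by_cases e : i = j
          · subst e; simp [TGWGen.deg]; ring
          · simp [TGWGen.deg, List.count_cons_of_ne e, Pi.single_eq_of_ne' e]
      · refine ⟨1, i :: u, v, List.disjoint_cons_left.2 ⟨hi, hd⟩, ?_, ?_⟩
        · rw [countVec_cons, TGWGen.deg]; abel
        · rw [map_one, one_mul, ys_cons, mul_assoc]; rfl

/-- The degree of a reduced word determines how often each letter occurs. -/
lemma count_of_disjoint {u v : List (Fin n)} (h : u.Disjoint v) {g : Fin n → ℤ}
    (hg : countVec v - countVec u = g) (j : Fin n) :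
    (u.count j : ℤ) = max 0 (-g j) ∧ (v.count j : ℤ) = max 0 (g j) := by
  have e := congrFun hg j
  simp only [Pi.sub_apply, countVec_apply] at e
  by_cases hj : j ∈ u
  · have := List.count_eq_zero_of_not_mem (h hj)
    omega
  · have := List.count_eq_zero_of_not_mem hj
    omega

lemma eq_of_count {v w : List (Fin n)} (hw : w.length ≤ 1) (h : ∀ j, v.count j = w.count j) :
    v = w := by
  have hp : v.Perm w := List.perm_iff_count.2 h
  match w, hw with
  | [], _ => exact hp.eq_nil
  | [a], _ => exact List.perm_singleton.1 hp

/-- If `b` is the only reduced word of degree `g`, then `A_g = R b`. -/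
lemma component_le {g : Fin n → ℤ} {b : D.TGWA} (h : ∀ u v : List (Fin n), u.Disjoint v →
    countVec v - countVec u = g → D.ys u * D.xs v = b) {a : D.TGWA} (ha : a ∈ D.component g) :
    ∃ r, a = D.ofCoeff r * b := by
  have hle : D.component g ≤
      LinearMap.range ((LinearMap.mulRight k b).comp D.ofCoeff.toLinearMap) := by
    rw [component_eq_span, Submodule.span_le]
    rintro _ ⟨w, rfl, rfl⟩
    obtain ⟨r, u, v, hd, hg, hw⟩ := exists_reduced_word (D := D) w
    exact ⟨r, by rw [hw, h u v hd hg]; rfl⟩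
  obtain ⟨r, hr⟩ := hle ha
  exact ⟨r, hr.symm⟩

/-- `A_0 = R`. -/
lemma exists_of_mem_zero {a : D.TGWA} (ha : a ∈ D.component 0) : ∃ r, a = D.ofCoeff r := by
  obtain ⟨r, hr⟩ := component_le (b := 1) (fun u v hd hg => by
    have hu : u = [] := eq_of_count (by simp) fun j => by
      have := (count_of_disjoint hd hg j).1; simpa using this
    have hv : v = [] := eq_of_count (by simp) fun j => by
      have := (count_of_disjoint hd hg j).2; simpa using this
    simp [hu, hv]) ha
  exact ⟨r, by rw [hr, mul_one]⟩

/-- `A_{e_i} = R X_i`. -/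
lemma exists_of_mem_single {i : Fin n} {a : D.TGWA} (ha : a ∈ D.component (Pi.single i 1)) :
    ∃ r, a = D.ofCoeff r * D.x i := by
  refine component_le (fun u v hd hg => ?_) ha
  have hu : u = [] := eq_of_count (by simp) fun j => by
    have h := (count_of_disjoint hd hg j).1
    by_cases e : i = j
    · subst e; simp at h ⊢; omega
    · simp [Pi.single_eq_of_ne' e] at h ⊢; omega
  have hv : v = [i] := eq_of_count (by simp) fun j => by
    have h := (count_of_disjoint hd hg j).2
    by_cases e : i = j
    · subst e; simp at h ⊢; omega
    · simp [e] at h ⊢; omega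
  simp [hu, hv, xs_cons]

/-- `A_{-e_i} = R Y_i`. -/
lemma exists_of_mem_neg_single {i : Fin n} {a : D.TGWA}
    (ha : a ∈ D.component (-Pi.single i 1)) : ∃ r, a = D.ofCoeff r * D.y i := by
  refine component_le (fun u v hd hg => ?_) ha
  have hv : v = [] := eq_of_count (by simp) fun j => by
    have h := (count_of_disjoint hd hg j).2
    by_cases e : i = j
    · subst e; simp at h ⊢; omega
    · simp [Pi.single_eq_of_ne' e] at h ⊢; omega
  have hu : u = [i] := eq_of_count (by simp) fun j => by
    have h := (count_of_disjoint hd hg j).1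
    by_cases e : i = j
    · subst e; simp at h ⊢; omega
    · simp [e] at h ⊢; omega
  simp [hu, hv, ys_cons]

end TGWDatum

namespace TGWDatum

variable {k R : Type*} [CommRing k] [CommRing R] [Algebra k R] {n : ℕ} {D : TGWDatum k R n}

/-! ### Consequences of regularity and of the type `A_1 × ⋯ × A_1` -/

lemma isRegular_x (hreg : D.IsRegularlyGraded) (i : Fin n) : IsRegular (D.x i) := by
  obtain ⟨a, ha, h⟩ := hreg (Pi.single i 1)
  obtain ⟨r, rfl⟩ := exists_of_mem_single ha
  refine ⟨h.left.of_mul, ?_⟩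
  rw [D.ofCoeff_mul_of_mem (D.x_mem i)] at h
  exact h.right.of_mul

lemma isRegular_y (hreg : D.IsRegularlyGraded) (i : Fin n) : IsRegular (D.y i) := by
  obtain ⟨a, ha, h⟩ := hreg (-Pi.single i 1)
  obtain ⟨r, rfl⟩ := exists_of_mem_neg_single ha
  refine ⟨h.left.of_mul, ?_⟩
  rw [D.ofCoeff_mul_of_mem (D.y_mem i)] at h
  exact h.right.of_mul

lemma isRegular_xs (hreg : D.IsRegularlyGraded) (v : List (Fin n)) : IsRegular (D.xs v) := by
  induction v with
  | nil => exact isRegular_one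
  | cons i v ih => rw [xs_cons]; exact (isRegular_x hreg i).mul ih

/-- `t_i` can be cancelled in `R`. -/
lemma eq_of_mul_t_eq (hc : Function.Injective D.ofCoeff) (hreg : D.IsRegularlyGraded) {i : Fin n}
    {r s : R} (h : r * D.t i = s * D.t i) : r = s := by
  have ht : IsRegular (D.ofCoeff (D.t i)) := by
    rw [← y_mul_x]; exact (isRegular_y hreg i).mul (isRegular_x hreg i)
  refine hc (ht.right ?_)
  simpa only [map_mul] using congrArg D.ofCoeff h

lemma leftRelation_one (hfin : D.IsFinitistic) (hLie : D.IsLieTypeA1) {i j : Fin n} (hij : i ≠ j) :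
    D.LeftRelation i j 1 := by
  have h := congrFun (congrFun hLie i) j
  rw [Matrix.diagonal_apply_ne _ hij, cartanMatrix, Matrix.of_apply, if_neg hij] at h
  have h1 : D.mij i j = 1 := by omega
  have h2 : D.mij i j ∈ {m | D.LeftRelation i j m} := Nat.sInf_mem (hfin.1 i j hij)
  rwa [h1] at h2

/-- In type `A_1 × ⋯ × A_1` the automorphism `σ_i` multiplies `t_j`, `j ≠ i`, by a unit. -/
lemma exists_sigma_t (hc : Function.Injective D.ofCoeff) (hreg : D.IsRegularlyGraded)
    (hfin : D.IsFinitistic) (hLie : D.IsLieTypeA1) {i j : Fin n} (hij : i ≠ j) :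
    ∃ u : Rˣ, D.sigma i (D.t j) = u * D.t j := by
  obtain ⟨s, hs⟩ := leftRelation_one hfin hLie hij
  simp only [pow_one, Finset.Icc_self, Finset.sum_singleton, Nat.sub_self, pow_zero,
    AlgEquiv.one_apply] at hs
  have h₁ : D.sigma i (D.t j) = -s 1 * D.t j := by linear_combination hs
  obtain ⟨m, s', hs'⟩ := hfin.2 i j hij
  -- all `σ_i^l(t_j)` with `l > 0` are multiples of `σ_i(t_j)`, so a right relation gives one of
  -- length one
  have h₂ : ∀ l, D.sigma i (D.t j) ∣ (D.sigma i ^ (l + 1)) (D.t j) := by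
    intro l
    induction l with
    | zero => simp
    | succ l ih =>
      have e : (D.sigma i ^ (l + 1 + 1)) (D.t j) =
          (D.sigma i ^ (l + 1)) (-s 1) * (D.sigma i ^ (l + 1)) (D.t j) := by
        rw [pow_succ, AlgEquiv.mul_apply, h₁, map_mul]
      rw [e]
      exact ih.mul_left _
  have h₃ : D.sigma i (D.t j) ∣ D.t j := by
    rw [← dvd_add_left (Finset.dvd_sum fun l hl => ?_), hs']
    · exact dvd_zero _
    · obtain ⟨l, rfl⟩ : ∃ l', l = l' + 1 := ⟨l - 1, by rw [Finset.mem_Icc] at hl; omega⟩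
      exact (h₂ l).mul_left _
  obtain ⟨q, hq⟩ := h₃
  have h₄ : -s 1 * q = 1 := eq_of_mul_t_eq hc hreg (i := j) <| by
    rw [one_mul]
    nth_rewrite 2 [hq]
    rw [h₁]; ring
  exact ⟨⟨-s 1, q, h₄, by rw [mul_comm, h₄]⟩, h₁⟩

/-- The form in which the hypotheses on the datum are used: `R` embeds into `A`, `A` is regularly
graded, and `σ_i` multiplies `t_j` by a unit whenever `i ≠ j`. -/
structure Admissible (D : TGWDatum k R n) : Prop where
  inj : Function.Injective D.ofCoeff
  reg : D.IsRegularlyGraded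
  sigma_t : ∀ {i j : Fin n}, i ≠ j → ∃ u : Rˣ, D.sigma i (D.t j) = u * D.t j

lemma Admissible.of_hyp (hinj : Function.Injective D.iota) (hreg : D.IsRegularlyGraded)
    (hfin : D.IsFinitistic) (hLie : D.IsLieTypeA1) : D.Admissible :=
  have hc := D.ofCoeff_injective hinj
  ⟨hc, hreg, exists_sigma_t hc hreg hfin hLie⟩

namespace Admissible

variable (hD : D.Admissible)
include hD

lemma act_t {g : Fin n → ℤ} {j : Fin n} (hg : g j = 0) : ∃ u : Rˣ, D.act g (D.t j) = u * D.t j := by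
  let S : AddSubgroup (Fin n → ℤ) :=
    { carrier := {g | ∃ u : Rˣ, D.act g (D.t j) = u * D.t j}
      zero_mem' := ⟨1, by simp⟩
      add_mem' := by
        rintro g h ⟨u, hu⟩ ⟨v, hv⟩
        exact ⟨Units.map (D.act g : R →* R) v * u, by
          rw [act_add, hv, map_mul, hu, Units.val_mul, mul_assoc]; rfl⟩
      neg_mem' := by
        rintro g ⟨u, hu⟩
        refine ⟨Units.map (D.act (-g) : R →* R) u⁻¹, ?_⟩
        have h := congrArg (D.act (-g)) hu
        rw [act_neg_act, map_mul] at h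
        have e : D.act (-g) (↑u⁻¹ : R) * D.act (-g) u = 1 := by
          rw [← map_mul, Units.inv_mul, map_one]
        change _ = D.act (-g) (↑u⁻¹ : R) * D.t j
        nth_rewrite 2 [h]
        rw [← mul_assoc, e, one_mul] }
  have hS : g ∈ S := by
    rw [← Finset.univ_sum_single g]
    refine S.sum_mem fun i _ => ?_
    by_cases e : i = j
    · subst e; rw [hg, Pi.single_zero]; exact S.zero_mem
    · have : (Pi.single i (g i) : Fin n → ℤ) = g i • Pi.single i 1 := by
        rw [← Pi.single_smul, smul_eq_mul, mul_one]
      rw [this]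
      exact S.zsmul_mem (hD.sigma_t e) _
  exact hS

lemma assoc_x_x (i j : Fin n) : D.Assoc (D.x i * D.x j) (D.x j * D.x i) := by
  by_cases hij : i = j
  · subst hij; exact Assoc.refl _
  obtain ⟨u, hu⟩ := hD.sigma_t (Ne.symm hij)
  obtain ⟨m, hm⟩ := assoc_x_y (D := D) (Ne.symm hij)
  -- compare both sides after multiplication by the regular element `Y_i Y_j`
  refine ⟨Units.map (D.sigma i : R →* R) (m * u⁻¹),
    ((isRegular_y hD.reg i).mul (isRegular_y hD.reg j)).right ?_⟩
  have h₁ : D.x i * D.x j * (D.y i * D.y j) =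
      D.ofCoeff (D.sigma i m * D.sigma i (D.t i) * D.sigma j (D.t j)) := by
    calc D.x i * D.x j * (D.y i * D.y j) = D.x i * (D.x j * D.y i) * D.y j := by
          simp only [mul_assoc]
      _ = (D.x i * D.ofCoeff m) * D.y i * (D.x j * D.y j) := by rw [hm]; simp only [mul_assoc]
      _ = D.ofCoeff (D.sigma i m) * (D.x i * D.y i) * (D.x j * D.y j) := by
          rw [x_mul_ofCoeff]; simp only [mul_assoc]
      _ = _ := by rw [x_mul_y, x_mul_y, map_mul, map_mul]
  have h₂ : D.x j * D.x i * (D.y i * D.y j) =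
      D.ofCoeff (D.sigma i u * D.sigma i (D.t i) * D.sigma j (D.t j)) := by
    calc D.x j * D.x i * (D.y i * D.y j) = D.x j * (D.x i * D.y i) * D.y j := by
          simp only [mul_assoc]
      _ = D.ofCoeff (D.sigma j (D.sigma i (D.t i))) * (D.x j * D.y j) := by
          rw [x_mul_y, x_mul_ofCoeff, mul_assoc]
      _ = _ := by
          rw [x_mul_y, ← map_mul, ← act_single, ← act_single, act_comm, act_single, act_single, hu,
            map_mul (D.sigma i)]
  have e : D.sigma i (m * ↑u⁻¹) * D.sigma i u = D.sigma i m := by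
    rw [← map_mul, mul_assoc, Units.inv_mul, mul_one]
  change D.x i * D.x j * (D.y i * D.y j) =
    D.ofCoeff (D.sigma i (m * ↑u⁻¹)) * (D.x j * D.x i) * (D.y i * D.y j)
  rw [mul_assoc (D.ofCoeff _), h₁, h₂, ← map_mul D.ofCoeff]
  congr 1
  linear_combination (-D.sigma i (D.t i) * D.sigma j (D.t j)) * e

lemma assoc_y_y (i j : Fin n) : D.Assoc (D.y i * D.y j) (D.y j * D.y i) := by
  by_cases hij : i = j
  · subst hij; exact Assoc.refl _
  obtain ⟨u, hu⟩ := hD.act_t (j := j) (g := -Pi.single i 1) (by simp [Ne.symm hij])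
  rw [act_neg_single] at hu
  obtain ⟨m, hm⟩ := (assoc_x_y (D := D) (Ne.symm hij)).symm
  -- compare both sides after multiplication by the regular element `X_j X_i`
  refine ⟨u * Units.map ((D.sigma j).symm : R →* R) m⁻¹,
    ((isRegular_x hD.reg j).mul (isRegular_x hD.reg i)).right ?_⟩
  have h₁ : D.y i * D.y j * (D.x j * D.x i) = D.ofCoeff (u * (D.t j * D.t i)) := by
    calc D.y i * D.y j * (D.x j * D.x i) = D.y i * (D.y j * D.x j) * D.x i := by
          simp only [mul_assoc]
      _ = _ := by rw [y_mul_x, y_mul_ofCoeff, mul_assoc, y_mul_x, hu, ← map_mul, mul_assoc]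
  have h₂ : D.y j * D.y i * (D.x j * D.x i) =
      D.ofCoeff ((D.sigma j).symm m * (D.t j * D.t i)) := by
    calc D.y j * D.y i * (D.x j * D.x i) = D.y j * (D.y i * D.x j) * D.x i := by
          simp only [mul_assoc]
      _ = (D.y j * D.ofCoeff m) * D.x j * (D.y i * D.x i) := by rw [hm]; simp only [mul_assoc]
      _ = D.ofCoeff ((D.sigma j).symm m) * (D.y j * D.x j) * (D.y i * D.x i) := by
          rw [y_mul_ofCoeff]; simp only [mul_assoc]
      _ = _ := by rw [y_mul_x, y_mul_x, ← map_mul, ← map_mul, mul_assoc]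
  have e : (D.sigma j).symm (↑m⁻¹ : R) * (D.sigma j).symm m = 1 := by
    rw [← map_mul, Units.inv_mul, map_one]
  change D.y i * D.y j * (D.x j * D.x i) =
    D.ofCoeff (u * (D.sigma j).symm (↑m⁻¹ : R)) * (D.y j * D.y i) * (D.x j * D.x i)
  rw [mul_assoc (D.ofCoeff _), h₁, h₂, ← map_mul]
  congr 1
  linear_combination (-(u : R) * (D.t j * D.t i)) * e

lemma assoc_xs_of_perm {v w : List (Fin n)} (h : v.Perm w) : D.Assoc (D.xs v) (D.xs w) := by
  induction h with
  | nil => exact Assoc.refl _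
  | cons i _ ih => rw [xs_cons, xs_cons]; exact ih.mul_left (D.x_mem i)
  | swap i j v =>
    simp only [xs_cons, ← mul_assoc]
    exact (hD.assoc_x_x j i).mul_right _
  | trans _ _ h₁ h₂ => exact h₁.trans h₂

lemma assoc_ys_of_perm {v w : List (Fin n)} (h : v.Perm w) : D.Assoc (D.ys v) (D.ys w) := by
  induction h with
  | nil => exact Assoc.refl _
  | cons i _ ih => rw [ys_cons, ys_cons]; exact ih.mul_left (D.y_mem i)
  | swap i j v =>
    simp only [ys_cons, ← mul_assoc]
    exact (hD.assoc_y_y j i).mul_right _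
  | trans _ _ h₁ h₂ => exact h₁.trans h₂

end Admissible

/-! ### Factoring powers of `X_i` and `Y_i` out of homogeneous elements -/

lemma perm_replicate_append {v : List (Fin n)} {i : Fin n} {m : ℕ} (h : v.count i = m) :
    ∃ v', v.Perm (List.replicate m i ++ v') := by
  induction m generalizing v with
  | zero => exact ⟨v, List.Perm.refl _⟩
  | succ m ih =>
    have hi : i ∈ v := List.count_pos_iff.1 (by omega)
    obtain ⟨v', hv'⟩ := ih (v := v.erase i) (by rw [List.count_erase_self]; omega)
    exact ⟨v', (List.perm_cons_erase hi).trans (hv'.cons i)⟩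

/-- To show that all elements of `A_g` factor through a subspace, it suffices to consider reduced
words. -/
lemma component_le_of_reduced {g : Fin n → ℤ} (S : Submodule k D.TGWA)
    (hS : ∀ r, ∀ a ∈ S, D.ofCoeff r * a ∈ S)
    (h : ∀ u v : List (Fin n), u.Disjoint v → countVec v - countVec u = g →
      ∃ b ∈ S, D.Assoc (D.ys u * D.xs v) b) : D.component g ≤ S := by
  rw [component_eq_span, Submodule.span_le]
  rintro _ ⟨w, rfl, rfl⟩
  obtain ⟨r, u, v, hd, hg, hw⟩ := exists_reduced_word (D := D) w
  obtain ⟨b, hb, e, he⟩ := h u v hd hg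
  rw [hw, he]
  exact hS _ _ (hS _ _ hb)

variable (hD : D.Admissible)
include hD

/-- If `g_i ≥ 0`, every element of `A_g` is divisible by `X_i ^ g_i` on the left. -/
lemma Admissible.exists_eq_x_pow_mul {g : Fin n → ℤ} {i : Fin n} {m : ℕ} (hm : g i = m)
    {a : D.TGWA}
    (ha : a ∈ D.component g) : ∃ b, a = D.x i ^ m * b := by
  have hX : D.x i ^ m ∈ D.component (countVec (List.replicate m i)) := by
    rw [← xs_replicate]; exact D.xs_mem _
  have := component_le_of_reduced (D := D) (g := g)
    (LinearMap.range (LinearMap.mulLeft k (D.x i ^ m))) ?_ ?_ ha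
  · obtain ⟨b, hb⟩ := this
    exact ⟨b, hb.symm⟩
  · rintro r _ ⟨b, rfl⟩
    refine ⟨D.ofCoeff (D.act (-countVec (List.replicate m i)) r) * b, ?_⟩
    rw [LinearMap.mulLeft_apply, LinearMap.mulLeft_apply, ← mul_assoc, ← mul_assoc,
      D.ofCoeff_mul_of_mem hX]
  · intro u v hd hg
    have hc := count_of_disjoint hd hg i
    rw [hm] at hc
    obtain ⟨v', hv'⟩ := perm_replicate_append (v := v) (i := i) (m := m) (by omega)
    have hd' : u.Disjoint (List.replicate m i) := fun j hj hj' =>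
      hd hj (hv'.symm.subset (List.mem_append_left _ hj'))
    refine ⟨_, ⟨D.ys u * D.xs v', rfl⟩, ?_⟩
    refine ((hD.assoc_xs_of_perm hv').mul_left (D.ys_mem u)).trans ?_
    have h₁ := (assoc_xs_ys (D := D) hd').symm.mul_right (D.xs v')
    rw [xs_replicate] at h₁
    rw [LinearMap.mulLeft_apply, xs_append, xs_replicate, ← mul_assoc, ← mul_assoc]
    exact h₁

/-- If `g_i ≤ 0`, every element of `A_g` is divisible by `Y_i ^ (-g_i)` on the left. -/
lemma Admissible.exists_eq_y_pow_mul {g : Fin n → ℤ} {i : Fin n} {m : ℕ} (hm : g i = -m)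
    {a : D.TGWA}
    (ha : a ∈ D.component g) : ∃ b, a = D.y i ^ m * b := by
  have hY : D.y i ^ m ∈ D.component (-countVec (List.replicate m i)) := by
    rw [← ys_replicate]; exact D.ys_mem _
  have := component_le_of_reduced (D := D) (g := g)
    (LinearMap.range (LinearMap.mulLeft k (D.y i ^ m))) ?_ ?_ ha
  · obtain ⟨b, hb⟩ := this
    exact ⟨b, hb.symm⟩
  · rintro r _ ⟨b, rfl⟩
    refine ⟨D.ofCoeff (D.act (countVec (List.replicate m i)) r) * b, ?_⟩
    rw [LinearMap.mulLeft_apply, LinearMap.mulLeft_apply, ← mul_assoc, ← mul_assoc,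
      D.ofCoeff_mul_of_mem hY, neg_neg]
  · intro u v hd hg
    have hc := count_of_disjoint hd hg i
    rw [hm] at hc
    obtain ⟨u', hu'⟩ := perm_replicate_append (v := u) (i := i) (m := m) (by omega)
    refine ⟨_, ⟨D.ys u' * D.xs v, rfl⟩, ?_⟩
    have h₁ := (hD.assoc_ys_of_perm hu').mul_right (D.xs v)
    rwa [ys_append, ys_replicate, mul_assoc] at h₁

/-- If `g_i ≥ 0`, every element of `A_g` is divisible by `X_i ^ g_i` on the right, with a
homogeneous quotient. -/
lemma Admissible.exists_eq_mul_x_pow {g : Fin n → ℤ} {i : Fin n} {m : ℕ} (hm : g i = m)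
    {a : D.TGWA}
    (ha : a ∈ D.component g) :
    ∃ b ∈ D.component (g - m • Pi.single i 1), a = b * D.x i ^ m := by
  have := component_le_of_reduced (D := D) (g := g)
    ((D.component (g - m • Pi.single i 1)).map (LinearMap.mulRight k (D.x i ^ m))) ?_ ?_ ha
  · obtain ⟨b, hb, e⟩ := this
    exact ⟨b, hb, e.symm⟩
  · rintro r _ ⟨b, hb, rfl⟩
    refine ⟨D.ofCoeff r * b, ?_, mul_assoc _ _ _⟩
    simpa using D.mul_mem_component (D.ofCoeff_mem r) hb
  · intro u v hd hg
    have hc := count_of_disjoint hd hg i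
    rw [hm] at hc
    obtain ⟨v', hv'⟩ := perm_replicate_append (v := v) (i := i) (m := m) (by omega)
    have hv'' := hv'.trans List.perm_append_comm
    refine ⟨_, ⟨D.ys u * D.xs v', ?_, rfl⟩, ?_⟩
    · have := D.mul_mem_component (D.ys_mem u) (D.xs_mem v')
      refine (congrArg (fun h => _ ∈ D.component h) ?_).mpr this
      rw [← hg]
      ext j
      have e := hv'.count_eq j
      rw [List.count_append, List.count_replicate] at e
      by_cases hj : i = j
      · subst hj; simp at e ⊢; omega
      · simp [hj] at e ⊢; omega
    · have h₁ := (hD.assoc_xs_of_perm hv'').mul_left (D.ys_mem u)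
      rwa [xs_append, xs_replicate, ← mul_assoc] at h₁

/-- If `g_i ≤ 0`, every element of `A_g` is divisible by `Y_i ^ (-g_i)` on the right, with a
homogeneous quotient. -/
lemma Admissible.exists_eq_mul_y_pow {g : Fin n → ℤ} {i : Fin n} {m : ℕ} (hm : g i = -m)
    {a : D.TGWA}
    (ha : a ∈ D.component g) :
    ∃ b ∈ D.component (g + m • Pi.single i 1), a = b * D.y i ^ m := by
  have := component_le_of_reduced (D := D) (g := g)
    ((D.component (g + m • Pi.single i 1)).map (LinearMap.mulRight k (D.y i ^ m))) ?_ ?_ ha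
  · obtain ⟨b, hb, e⟩ := this
    exact ⟨b, hb, e.symm⟩
  · rintro r _ ⟨b, hb, rfl⟩
    refine ⟨D.ofCoeff r * b, ?_, mul_assoc _ _ _⟩
    simpa using D.mul_mem_component (D.ofCoeff_mem r) hb
  · intro u v hd hg
    have hc := count_of_disjoint hd hg i
    rw [hm] at hc
    obtain ⟨u', hu'⟩ := perm_replicate_append (v := u) (i := i) (m := m) (by omega)
    have hu'' := hu'.trans List.perm_append_comm
    have hd' : (List.replicate m i).Disjoint v := fun j hj hj' =>
      hd (hu'.symm.subset (List.mem_append_left _ hj)) hj'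
    refine ⟨_, ⟨D.ys u' * D.xs v, ?_, rfl⟩, ?_⟩
    · have := D.mul_mem_component (D.ys_mem u') (D.xs_mem v)
      refine (congrArg (fun h => _ ∈ D.component h) ?_).mpr this
      rw [← hg]
      ext j
      have e := hu'.count_eq j
      rw [List.count_append, List.count_replicate] at e
      by_cases hj : i = j
      · subst hj; simp at e ⊢; omega
      · simp [hj] at e ⊢; omega
    · refine ((hD.assoc_ys_of_perm hu'').mul_right (D.xs v)).trans ?_
      have h₁ := (assoc_xs_ys (D := D) hd').symm.mul_left (D.ys_mem u')
      rwa [ys_append, mul_assoc, LinearMap.mulRight_apply, ← ys_replicate, mul_assoc]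

omit hD

/-- The factor `σ_i^d(t_i)` of `X_i^N Y_i^N = σ_i(t_i) ⋯ σ_i^N(t_i)`. -/
lemma exists_x_pow_mul_y_pow (i : Fin n) {d N : ℕ} (hd : 0 < d) (hN : d ≤ N) :
    ∃ q, D.x i ^ N * D.y i ^ N = D.ofCoeff ((D.sigma i ^ d) (D.t i) * q) := by
  have step : ∀ (N : ℕ) (p : R), D.x i ^ N * D.y i ^ N = D.ofCoeff p →
      D.x i ^ (N + 1) * D.y i ^ (N + 1) = D.ofCoeff (D.sigma i p * D.sigma i (D.t i)) := by
    intro N p h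
    calc D.x i ^ (N + 1) * D.y i ^ (N + 1) = D.x i * (D.x i ^ N * D.y i ^ N) * D.y i := by
          rw [pow_succ', pow_succ]; simp only [mul_assoc]
      _ = _ := by rw [h, x_mul_ofCoeff, mul_assoc, x_mul_y, map_mul]
  induction N generalizing d with
  | zero => omega
  | succ N ih =>
    obtain rfl | h := Nat.eq_or_lt_of_le (Nat.succ_le_of_lt hd)
    · have hp : ∀ N, ∃ p, D.x i ^ N * D.y i ^ N = D.ofCoeff p := by
        intro N
        induction N with
        | zero => exact ⟨1, by simp⟩
        | succ N ih => obtain ⟨p, hp⟩ := ih; exact ⟨_, step N p hp⟩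
      obtain ⟨p, hp⟩ := hp N
      exact ⟨D.sigma i p, by rw [step N p hp, mul_comm]; rfl⟩
    · obtain ⟨d, rfl⟩ : ∃ d', d = d' + 1 := ⟨d - 1, by omega⟩
      obtain ⟨q, hq⟩ := ih (d := d) (by omega) (by omega)
      refine ⟨D.sigma i q * D.sigma i (D.t i), ?_⟩
      rw [step N _ hq, map_mul (D.sigma i), mul_assoc, pow_succ', AlgEquiv.mul_apply]

/-- The factor `t_i` of `Y_i^N X_i^N = t_i σ_i^{-1}(t_i) ⋯ σ_i^{-(N-1)}(t_i)`. -/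
lemma exists_y_pow_mul_x_pow (i : Fin n) {N : ℕ} (hN : 0 < N) :
    ∃ q, D.y i ^ N * D.x i ^ N = D.ofCoeff (D.t i * q) := by
  have step : ∀ (N : ℕ) (p : R), D.y i ^ N * D.x i ^ N = D.ofCoeff p →
      D.y i ^ (N + 1) * D.x i ^ (N + 1) = D.ofCoeff (D.t i * (D.sigma i).symm p) := by
    intro N p h
    calc D.y i ^ (N + 1) * D.x i ^ (N + 1) = D.y i * (D.y i ^ N * D.x i ^ N) * D.x i := by
          rw [pow_succ', pow_succ]; simp only [mul_assoc]
      _ = _ := by rw [h, y_mul_ofCoeff, mul_assoc, y_mul_x, ← map_mul, mul_comm]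
  have hp : ∀ N, ∃ p, D.y i ^ N * D.x i ^ N = D.ofCoeff p := by
    intro N
    induction N with
    | zero => exact ⟨1, by simp⟩
    | succ N ih => obtain ⟨p, hp⟩ := ih; exact ⟨_, step N p hp⟩
  obtain ⟨N, rfl⟩ : ∃ N', N = N' + 1 := ⟨N - 1, by omega⟩
  obtain ⟨p, hp⟩ := hp N
  exact ⟨_, step N p hp⟩

end TGWDatum

namespace TGWDatum

variable {k R : Type*} [CommRing k] [CommRing R] [Algebra k R] {n : ℕ} {D : TGWDatum k R n}

/-! ### Necessity of the three conditions -/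

variable (D) in
/-- The elements of `A` all of whose two-sided multiples have their component of degree `0` in the
ideal `J` of `R`. -/
def core (J : Ideal R) : TwoSidedIdeal D.TGWA :=
  .mk' {a | ∀ b c, ∃ r ∈ J, D.comp 0 (b * a * c) = D.ofCoeff r}
    (fun b c => ⟨0, J.zero_mem, by simp⟩)
    (fun {a a'} ha ha' b c => by
      obtain ⟨r, hr, h⟩ := ha b c
      obtain ⟨r', hr', h'⟩ := ha' b c
      exact ⟨r + r', J.add_mem hr hr', by rw [mul_add, add_mul, map_add, h, h', map_add]⟩)
    (fun {a} ha b c => by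
      obtain ⟨r, hr, h⟩ := ha (-b) c
      have e : b * -a * c = -b * a * c := by rw [mul_neg, neg_mul b a]
      exact ⟨r, hr, by rw [e, h]⟩)
    (fun {x y} hy b c => by simpa only [mul_assoc] using hy (b * x) c)
    (fun {x y} hx b c => by simpa only [mul_assoc] using hx b (y * c))

lemma mem_core {J : Ideal R} {a : D.TGWA} :
    a ∈ D.core J ↔ ∀ b c, ∃ r ∈ J, D.comp 0 (b * a * c) = D.ofCoeff r :=
  TwoSidedIdeal.mem_mk' _ _ _ _ _ _ _

/-- It suffices to test membership in `core J` on homogeneous multiples. -/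
lemma mem_core_of_homogeneous {J : Ideal R} {a : D.TGWA}
    (h : ∀ g₁ g₂, ∀ b ∈ D.component g₁, ∀ c ∈ D.component g₂,
      ∃ r ∈ J, D.comp 0 (b * a * c) = D.ofCoeff r) : a ∈ D.core J := by
  rw [mem_core]
  intro b c
  induction b using D.homogeneous_induction with
  | hom g b hb =>
    induction c using D.homogeneous_induction with
    | hom g' c hc => exact h g g' b hb c hc
    | add c c' hc hc' =>
      obtain ⟨r, hr, e⟩ := hc
      obtain ⟨r', hr', e'⟩ := hc'
      exact ⟨r + r', J.add_mem hr hr', by rw [mul_add, map_add, e, e', map_add]⟩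
  | add b b' hb hb' =>
    obtain ⟨r, hr, e⟩ := hb
    obtain ⟨r', hr', e'⟩ := hb'
    exact ⟨r + r', J.add_mem hr hr', by rw [add_mul, add_mul, map_add, e, e', map_add]⟩

lemma comp_zero_eq (a : D.TGWA) : ∃ r, D.comp 0 a = D.ofCoeff r :=
  exists_of_mem_zero (D.comp_mem 0 a)

lemma comp_ofCoeff_mul (r : R) (g : Fin n → ℤ) (a : D.TGWA) :
    D.comp g (D.ofCoeff r * a) = D.ofCoeff r * D.comp g a := by
  rw [D.comp_mul_left (D.ofCoeff_mem r), sub_zero]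

/-- The degree `0` component of `b r c` lies in `J` if `b` is homogeneous of degree `g` and
`σ_g(r)` lies in `J`. -/
lemma exists_comp_zero {J : Ideal R} {g : Fin n → ℤ} {b : D.TGWA} (hb : b ∈ D.component g) {r : R}
    (hr : D.act g r ∈ J) (c : D.TGWA) :
    ∃ s ∈ J, D.comp 0 (b * D.ofCoeff r * c) = D.ofCoeff s := by
  obtain ⟨q, hq⟩ := comp_zero_eq (b * c)
  refine ⟨_, J.mul_mem_right q hr, ?_⟩
  rw [D.mul_ofCoeff_of_mem hb, mul_assoc, comp_ofCoeff_mul, hq, map_mul]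

variable (hD : D.Admissible)
include hD

lemma Admissible.eq_top_of_core {J : Ideal R} (h : D.core J = ⊤) : J = ⊤ := by
  have h1 : (1 : D.TGWA) ∈ D.core J := h ▸ trivial
  obtain ⟨r, hr, e⟩ := mem_core.1 h1 1 1
  rw [mul_one, mul_one, D.comp_of_mem D.one_mem_component, if_pos rfl, ← map_one D.ofCoeff] at e
  rw [Ideal.eq_top_iff_one, hD.inj e]
  exact hr

lemma Admissible.isZnSimple [IsSimpleRing D.TGWA] : D.IsZnSimple := by
  refine ⟨?_, fun J hJ => ?_⟩
  · by_contra h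
    rw [not_nontrivial_iff_subsingleton] at h
    have : (1 : D.TGWA) = 0 := by
      rw [← map_one D.ofCoeff, Subsingleton.elim (1 : R) 0, map_zero]
    exact one_ne_zero this
  · rcases eq_bot_or_eq_top (D.core J) with h | h
    · left
      rw [eq_bot_iff]
      intro r hr
      have hr' : D.ofCoeff r ∈ D.core J := by
        refine mem_core_of_homogeneous fun g _ b hb c _ => exists_comp_zero hb ?_ c
        rw [← hJ (Multiplicative.ofAdd g)]
        exact Ideal.mem_map_of_mem _ hr
      rw [h, TwoSidedIdeal.mem_bot] at hr'
      exact hD.inj (hr'.trans (map_zero D.ofCoeff).symm)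
    · exact Or.inr (hD.eq_top_of_core h)

/-- The degree `0` component of a two-sided multiple of `X_i^d` lies in the ideal generated by `t_i`
and `σ_i^d(t_i)`. -/
lemma Admissible.x_pow_mem_core {i : Fin n} {d : ℕ} (hd : 0 < d) :
    D.x i ^ d ∈ D.core (Ideal.span {(D.sigma i ^ d) (D.t i)} ⊔ Ideal.span {D.t i}) := by
  set J := Ideal.span {(D.sigma i ^ d) (D.t i)} ⊔ Ideal.span {D.t i} with hJ
  have ht : D.t i ∈ J := Ideal.mem_sup_right (Ideal.mem_span_singleton_self _)
  have hs : (D.sigma i ^ d) (D.t i) ∈ J := Ideal.mem_sup_left (Ideal.mem_span_singleton_self _)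
  have hx := D.x_pow_mem i d
  refine mem_core_of_homogeneous fun g₁ g₂ b hb c hc => ?_
  by_cases h0 : g₁ + d • Pi.single i 1 + g₂ = 0
  swap
  · refine ⟨0, J.zero_mem, ?_⟩
    rw [D.comp_of_mem (D.mul_mem_component (D.mul_mem_component hb hx) hc), if_neg h0, map_zero]
  have hi : g₁ i + d + g₂ i = 0 := by simpa using congrFun h0 i
  -- if `g₁ i ≥ 0`, the powers of `X_i` collect in front of at least as many factors `Y_i`, which
  -- yields `σ_i^d(t_i)`; otherwise some `Y_i` precede equally many `X_i`, which yields `t_i`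
  rcases le_or_gt 0 (g₁ i) with h | h
  · obtain ⟨m, hm⟩ := Int.eq_ofNat_of_zero_le h
    obtain ⟨b', hb', rfl⟩ := hD.exists_eq_mul_x_pow hm hb
    obtain ⟨c', rfl⟩ := hD.exists_eq_y_pow_mul (i := i) (m := m + d) (by push_cast; omega) hc
    obtain ⟨q, hq⟩ := exists_x_pow_mul_y_pow (D := D) i hd (Nat.le_add_left d m)
    have e : b' * D.x i ^ m * D.x i ^ d * (D.y i ^ (m + d) * c') =
        b' * (D.x i ^ (m + d) * D.y i ^ (m + d)) * c' := by
      rw [pow_add (D.x i)]; simp only [mul_assoc]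
    rw [e, hq]
    refine exists_comp_zero hb' ?_ c'
    obtain ⟨u, hu⟩ := hD.act_t (g := g₁ - m • Pi.single i 1) (j := i) (by simp [hm])
    rw [← act_nsmul_single] at hs ⊢
    rw [map_mul, act_comm, hu, map_mul]
    exact J.mul_mem_right _ (J.mul_mem_left _ hs)
  · obtain ⟨m, hm⟩ : ∃ m : ℕ, g₁ i = -(m : ℤ) := ⟨(-g₁ i).toNat, by omega⟩
    obtain ⟨b', hb', rfl⟩ := hD.exists_eq_mul_y_pow hm hb
    have hc' : ∃ c', D.x i ^ d * c = D.x i ^ m * c' := by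
      rcases le_total m d with hmd | hmd
      · exact ⟨D.x i ^ (d - m) * c, by rw [← mul_assoc, ← pow_add, Nat.add_sub_cancel' hmd]⟩
      · obtain ⟨c', rfl⟩ := hD.exists_eq_x_pow_mul (i := i) (m := m - d)
          (by rw [Nat.cast_sub hmd]; omega) hc
        exact ⟨c', by rw [← mul_assoc, ← pow_add, Nat.add_sub_cancel' hmd]⟩
    obtain ⟨c', hc'⟩ := hc'
    obtain ⟨q, hq⟩ := exists_y_pow_mul_x_pow (D := D) i (N := m) (by omega)
    have e : b' * D.y i ^ m * D.x i ^ d * c = b' * (D.y i ^ m * D.x i ^ m) * c' := by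
      rw [mul_assoc, hc']; simp only [mul_assoc]
    rw [e, hq]
    refine exists_comp_zero hb' ?_ c'
    obtain ⟨u, hu⟩ := hD.act_t (g := g₁ + m • Pi.single i 1) (j := i) (by simp [hm])
    rw [map_mul, hu]
    exact J.mul_mem_right _ (J.mul_mem_left _ ht)

lemma Admissible.sup_eq_top [IsSimpleRing D.TGWA] (i : Fin n) {d : ℕ} (hd : 0 < d) :
    Ideal.span {(D.sigma i ^ d) (D.t i)} ⊔ Ideal.span {D.t i} = ⊤ := by
  rcases eq_bot_or_eq_top (D.core (Ideal.span {(D.sigma i ^ d) (D.t i)} ⊔ Ideal.span {D.t i}))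
    with h | h
  · have h1 := hD.x_pow_mem_core (i := i) hd
    rw [h, TwoSidedIdeal.mem_bot, ← xs_replicate] at h1
    have h2 := (isRegular_xs hD.reg (List.replicate d i)).left (a₁ := 1) (a₂ := 0)
      (by simp [h1])
    exact absurd h2 one_ne_zero
  · exact hD.eq_top_of_core h

omit hD

/-- The homogeneous components of a central element are central. -/
lemma comp_comm_of_comm {z : D.TGWA} (hz : ∀ a, a * z = z * a) (g : Fin n → ℤ) (a : D.TGWA) :
    a * D.comp g z = D.comp g z * a := by
  induction a using D.homogeneous_induction with
  | hom h a ha =>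
    have e := congrArg (D.comp (g + h)) (hz a)
    rwa [D.comp_mul_left ha, D.comp_mul_right ha, add_sub_cancel_right] at e
  | add a b ha hb => rw [add_mul, ha, hb, mul_add]

/-- If `A` is simple, its center is concentrated in degree `0`: for a nonzero central homogeneous
element `z` of degree `g ≠ 0`, an inverse of `1 + z` would have infinite support. -/
lemma comp_eq_zero_of_comm [IsSimpleRing D.TGWA] {z : D.TGWA} (hz : ∀ a, a * z = z * a)
    {g : Fin n → ℤ} (hg : g ≠ 0) : D.comp g z = 0 := by
  by_contra hne
  have hw : ∀ a, a * D.comp g z = D.comp g z * a := comp_comm_of_comm hz g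
  have hmem : D.comp g z ∈ D.component g := D.comp_mem g z
  generalize D.comp g z = w at hne hw hmem
  have hinv : ∀ c : D.TGWA, (∀ a, a * c = c * a) → c ≠ 0 → ∃ b, b * c = 1 := by
    intro c hc hc0
    have hc' : c ∈ Subring.center D.TGWA := Subring.mem_center_iff.2 hc
    obtain ⟨b, hb⟩ := (IsSimpleRing.isField_center D.TGWA).mul_inv_cancel (a := ⟨c, hc'⟩)
      (fun h => hc0 (congrArg Subtype.val h))
    exact ⟨b, by rw [hc]; exact congrArg Subtype.val hb⟩
  obtain ⟨w', hw'⟩ := hinv w hw hne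
  have hcancel : ∀ a, a * w = 0 → a = 0 := fun a ha => by
    rw [← mul_one a, ← hw', hw w', ← mul_assoc, ha, zero_mul]
  have h1w : (1 : D.TGWA) + w ≠ 0 := by
    intro h
    have h2 := congrArg (D.comp 0) h
    rw [map_add, D.comp_of_mem D.one_mem_component, D.comp_of_mem hmem, if_pos rfl, if_neg hg,
      map_zero, add_zero] at h2
    exact one_ne_zero h2
  obtain ⟨b, hb⟩ := hinv (1 + w) (fun a => by rw [mul_add, add_mul, hw, mul_one, one_mul]) h1w
  -- comparing components in `b * (1 + w) = 1` relates the components of `b` along `ℤ g`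
  have hrec : ∀ h, D.comp h b + D.comp (h - g) b * w = if (0 : Fin n → ℤ) = h then 1 else 0 := by
    intro h
    rw [← D.comp_mul_right hmem, ← map_add, ← D.comp_of_mem D.one_mem_component, ← hb, mul_add,
      mul_one]
  have hinj : Function.Injective fun l : ℤ => l • g := by
    obtain ⟨j, hj⟩ := Function.ne_iff.1 hg
    intro l m h
    exact mul_right_cancel₀ hj (congrFun h j)
  have hfin : ∀ f : ℕ → ℤ, Function.Injective f → ¬ ∀ l, D.comp (f l • g) b ≠ 0 := by
    intro f hf h
    refine Set.infinite_range_of_injective (hinj.comp hf)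
      ((D.supp b).finite_toSet.subset ?_)
    rintro _ ⟨l, rfl⟩
    exact D.mem_supp.2 (h l)
  by_cases h0 : D.comp 0 b = 0
  · refine hfin (fun l => -(l + 1 : ℤ)) (fun l m h => by simpa using h) fun l => ?_
    induction l with
    | zero =>
      intro h
      have h3 := hrec 0
      rw [if_pos rfl, h0, zero_sub, zero_add] at h3
      simp only [Nat.cast_zero, zero_add, neg_smul, one_smul] at h
      rw [h, zero_mul] at h3
      exact zero_ne_one h3
    | succ l ih =>
      intro h
      have h3 := hrec (-(l + 1 : ℤ) • g)
      rw [if_neg] at h3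
      · have e : -(l + 1 : ℤ) • g - g = -((l + 1 : ℕ) + 1 : ℤ) • g := by
          push_cast; module
        rw [e, h, zero_mul, add_zero] at h3
        exact ih h3
      · intro h4
        have := hinj (a₁ := 0) (a₂ := -(l + 1 : ℤ)) (by simpa using h4)
        omega
  · refine hfin (fun l => (l : ℤ)) Nat.cast_injective fun l => ?_
    induction l with
    | zero => simpa using h0
    | succ l ih =>
      intro h
      have h3 := hrec ((l + 1 : ℕ) • g : Fin n → ℤ)
      rw [if_neg] at h3
      · have e : ((l + 1 : ℕ) • g : Fin n → ℤ) - g = (l : ℤ) • g := by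
          module
        have e' : ((l + 1 : ℕ) • g : Fin n → ℤ) = ((l + 1 : ℕ) : ℤ) • g := by
          push_cast; module
        rw [e, e', h, zero_add] at h3
        exact ih (hcancel _ h3)
      · intro h4
        have := hinj (a₁ := 0) (a₂ := ((l + 1 : ℕ) : ℤ)) (by simpa using h4)
        simp at this
        omega

lemma center_le [IsSimpleRing D.TGWA] : Subalgebra.center k D.TGWA ≤ D.ofCoeff.range := by
  intro z hz
  have hz' := Subalgebra.mem_center_iff.1 hz
  have h : z = D.comp 0 z := D.eq_of_comp_eq fun g => by
    rw [D.comp_of_mem (D.comp_mem 0 z)]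
    split_ifs with h
    · rw [h]
    · exact comp_eq_zero_of_comm hz' (Ne.symm h)
  obtain ⟨r, hr⟩ := comp_zero_eq z
  exact ⟨r, (h.trans hr).symm⟩

end TGWDatum

namespace TGWDatum

variable {k R : Type*} [CommRing k] [CommRing R] [Algebra k R] {n : ℕ} {D : TGWDatum k R n}

/-! ### Sufficiency of the three conditions -/

lemma countVec_append (v w : List (Fin n)) : countVec (v ++ w) = countVec v + countVec w := by
  ext j; simp

lemma exists_add_countVec_eq (g h : Fin n → ℤ) :
    ∃ v w : List (Fin n), g + countVec v = h + countVec w := by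
  let S : AddSubgroup (Fin n → ℤ) :=
    { carrier := {g | ∃ v w, g = countVec v - countVec w}
      zero_mem' := ⟨[], [], by simp⟩
      add_mem' := by
        rintro _ _ ⟨v, w, rfl⟩ ⟨v', w', rfl⟩
        exact ⟨v ++ v', w ++ w', by rw [countVec_append, countVec_append]; abel⟩
      neg_mem' := by
        rintro _ ⟨v, w, rfl⟩
        exact ⟨w, v, by abel⟩ }
  have hS : h - g ∈ S := by
    rw [← Finset.univ_sum_single (h - g)]
    refine S.sum_mem fun i _ => ?_
    have : (Pi.single i ((h - g) i) : Fin n → ℤ) = (h - g) i • Pi.single i 1 := by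
      rw [← Pi.single_smul, smul_eq_mul, mul_one]
    rw [this]
    exact S.zsmul_mem ⟨[i], [], by simp [countVec_cons]⟩ _
  obtain ⟨v, w, e⟩ := hS
  exact ⟨v, w, by rw [eq_sub_iff_add_eq] at e; rw [← e]; abel⟩

/-- Raising both the twist and the word in an element of the form `σ_g(r) X_v` of a two-sided
ideal. -/
lemma act_mul_xs_mem {K : TwoSidedIdeal D.TGWA} {g : Fin n → ℤ} {r : R} {v : List (Fin n)}
    (h : D.ofCoeff (D.act g r) * D.xs v ∈ K) (w v' : List (Fin n)) :
    D.ofCoeff (D.act (g + countVec w) r) * D.xs (w ++ v ++ v') ∈ K := by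
  have := K.mul_mem_right _ (D.xs v') (K.mul_mem_left (D.xs w) _ h)
  rwa [← mul_assoc, D.mul_ofCoeff_of_mem (D.xs_mem w), ← act_add, mul_assoc, mul_assoc,
    ← mul_assoc (D.xs w), ← xs_append, ← xs_append, add_comm] at this

variable (hD : D.Admissible)
include hD

lemma Admissible.ofCoeff_mul_xs_mem {K : TwoSidedIdeal D.TGWA} {r : R} {v w : List (Fin n)}
    (hp : v.Perm w) (h : D.ofCoeff r * D.xs v ∈ K) : D.ofCoeff r * D.xs w ∈ K :=
  ((hD.assoc_xs_of_perm hp).mul_left (D.ofCoeff_mem r)).mem_iff.1 h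

/-- The elements `r` of `R` some conjugate `σ_g(r)` of which is multiplied into `K` by a monomial in
the `X_i`. -/
def Admissible.invariantIdeal (K : TwoSidedIdeal D.TGWA) : Ideal R where
  carrier := {r | ∃ g v, D.ofCoeff (D.act g r) * D.xs v ∈ K}
  zero_mem' := ⟨0, [], by simp [K.zero_mem]⟩
  add_mem' := by
    rintro r r' ⟨g, v, h⟩ ⟨g', v', h'⟩
    obtain ⟨w, w', e⟩ := exists_add_countVec_eq g g'
    refine ⟨g + countVec w, w ++ v ++ (w' ++ v'), ?_⟩
    rw [map_add, map_add, add_mul]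
    refine K.add_mem (act_mul_xs_mem h _ _) ?_
    rw [e]
    refine hD.ofCoeff_mul_xs_mem ?_ (act_mul_xs_mem h' w' (w ++ v))
    exact List.perm_append_comm
  smul_mem' := by
    rintro s r ⟨g, v, h⟩
    refine ⟨g, v, ?_⟩
    rw [smul_eq_mul, map_mul, map_mul, mul_assoc]
    exact K.mul_mem_left _ _ h

/-- If `R` is `ℤ^n`-simple, a two-sided ideal meeting `R` contains a monomial in the `X_i`. -/
lemma Admissible.exists_xs_mem (hZ : D.IsZnSimple) {K : TwoSidedIdeal D.TGWA} {r : R} (hr : r ≠ 0)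
    (hK : D.ofCoeff r ∈ K) : ∃ v, D.xs v ∈ K := by
  have hinv : ∀ g, ∀ s ∈ hD.invariantIdeal K, D.act g s ∈ hD.invariantIdeal K := by
    rintro g s ⟨h, v, hs⟩
    exact ⟨h - g, v, by rwa [← act_add, sub_add_cancel]⟩
  have hmap : ∀ g, (hD.invariantIdeal K).map (D.σ g) = hD.invariantIdeal K := fun g => by
    refine le_antisymm (Ideal.map_le_iff_le_comap.2 fun s hs => hinv g.toAdd s hs) fun s hs => ?_
    rw [← D.act_act_neg g.toAdd s]
    exact Ideal.mem_map_of_mem (D.σ g) (hinv _ s hs)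
  rcases hZ.2 _ hmap with h | h
  · have hr' : r ∈ hD.invariantIdeal K := ⟨0, [], by simpa using hK⟩
    rw [h] at hr'
    exact absurd hr' hr
  · obtain ⟨g, v, h1⟩ : (1 : R) ∈ hD.invariantIdeal K := h ▸ trivial
    exact ⟨v, by simpa using h1⟩

/-- If each `t_i` is comaximal with its images under the positive powers of `σ_i`, a two-sided ideal
containing a monomial in the `X_i` contains `1`: multiplying the monomial by `Y_i` from the left and
from the right lowers the exponent of `X_i`, at the cost of the factors `t_i` and `σ_i^d(t_i)`. -/
lemma Admissible.one_mem_of_xs_mem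
    (ht : ∀ (i : Fin n) (d : ℕ), 0 < d →
      Ideal.span {(D.sigma i ^ d) (D.t i)} ⊔ Ideal.span {D.t i} = ⊤)
    {K : TwoSidedIdeal D.TGWA} {v : List (Fin n)} (hv : D.xs v ∈ K) : 1 ∈ K := by
  induction hl : v.length using Nat.strong_induction_on generalizing v with
  | _ l ih =>
  match v, hv with
  | [], hv => simpa using hv
  | i :: v₀, hv =>
    obtain ⟨d, hd⟩ : ∃ d, (i :: v₀).count i = d + 1 := ⟨_, List.count_cons_self⟩
    obtain ⟨w, hw⟩ := perm_replicate_append hd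
    have hiw : i ∉ w := by
      have e := hw.count_eq i
      rw [List.count_append, List.count_replicate_self] at e
      exact List.count_eq_zero.1 (by omega)
    have hmem : D.x i ^ (d + 1) * D.xs w ∈ K := by
      rw [← xs_replicate, ← xs_append]
      exact (hD.assoc_xs_of_perm hw).mem_iff.1 hv
    have hX := D.x_pow_mem i d
    have h₁ : D.ofCoeff (D.t i) * (D.x i ^ d * D.xs w) ∈ K := by
      have := K.mul_mem_left (D.y i) _ hmem
      rwa [pow_succ', ← mul_assoc, ← mul_assoc, y_mul_x, mul_assoc] at this
    have h₂ : D.ofCoeff ((D.sigma i ^ (d + 1)) (D.t i)) * (D.x i ^ d * D.xs w) ∈ K := by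
      have h := K.mul_mem_right _ (D.y i) hmem
      have hX' := D.mul_mem_component hX (D.x_mem i)
      rw [← pow_succ] at hX'
      rw [mul_assoc, ((assoc_xs_y (D := D) hiw).mul_left hX').mem_iff, ← mul_assoc, pow_succ,
        mul_assoc (D.x i ^ d), x_mul_y, D.mul_ofCoeff_of_mem hX, act_nsmul_single, mul_assoc] at h
      rwa [pow_succ, AlgEquiv.mul_apply]
    have h1 : (1 : R) ∈ Ideal.span {(D.sigma i ^ (d + 1)) (D.t i)} ⊔ Ideal.span {D.t i} := by
      rw [ht i (d + 1) d.succ_pos]; trivial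
    obtain ⟨_, hp, _, hq, e⟩ := Submodule.mem_sup.1 h1
    obtain ⟨p, rfl⟩ := Ideal.mem_span_singleton'.1 hp
    obtain ⟨q, rfl⟩ := Ideal.mem_span_singleton'.1 hq
    refine ih (d + w.length) ?_ (v := List.replicate d i ++ w) ?_ (by simp)
    · have := hw.length_eq
      simp at this hl
      omega
    · rw [xs_append, xs_replicate, ← one_mul (D.x i ^ d * D.xs w), ← map_one D.ofCoeff, ← e,
        map_add, add_mul, map_mul, map_mul, mul_assoc, mul_assoc]
      exact K.add_mem (K.mul_mem_left _ _ h₂) (K.mul_mem_left _ _ h₁)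

omit hD

variable (D) in
/-- The elements whose component in each degree `h` is also the component in degree `h` of an
element of `J` with support in the translate `F + h`. -/
def leadingIdeal (J : TwoSidedIdeal D.TGWA) (F : Finset (Fin n → ℤ)) : TwoSidedIdeal D.TGWA :=
  .mk' {a | ∀ h, ∃ b ∈ J, (∀ g ∉ F, D.comp (g + h) b = 0) ∧ D.comp h b = D.comp h a}
    (fun h => ⟨0, J.zero_mem, by simp⟩)
    (fun ha ha' h => by
      obtain ⟨b, hb, hF, e⟩ := ha h
      obtain ⟨b', hb', hF', e'⟩ := ha' h
      exact ⟨b + b', J.add_mem hb hb', fun g hg => by rw [map_add, hF g hg, hF' g hg, add_zero],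
        by rw [map_add, map_add, e, e']⟩)
    (fun ha h => by
      obtain ⟨b, hb, hF, e⟩ := ha h
      exact ⟨-b, J.neg_mem hb, fun g hg => by rw [map_neg, hF g hg, neg_zero],
        by rw [map_neg, map_neg, e]⟩)
    (fun {x a} ha => by
      induction x using D.homogeneous_induction with
      | hom e x hx =>
        intro h
        obtain ⟨b, hb, hF, e'⟩ := ha (h - e)
        refine ⟨x * b, J.mul_mem_left _ _ hb, fun g hg => ?_, ?_⟩
        · rw [D.comp_mul_left hx, add_sub_assoc, hF g hg, mul_zero]
        · rw [D.comp_mul_left hx, D.comp_mul_left hx, e']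
      | add x x' hx hx' =>
        intro h
        obtain ⟨b, hb, hF, e⟩ := hx h
        obtain ⟨b', hb', hF', e'⟩ := hx' h
        exact ⟨b + b', J.add_mem hb hb', fun g hg => by rw [map_add, hF g hg, hF' g hg, add_zero],
          by rw [add_mul, map_add, map_add, e, e']⟩)
    (fun {a x} ha => by
      induction x using D.homogeneous_induction with
      | hom e x hx =>
        intro h
        obtain ⟨b, hb, hF, e'⟩ := ha (h - e)
        refine ⟨b * x, J.mul_mem_right _ _ hb, fun g hg => ?_, ?_⟩
        · rw [D.comp_mul_right hx, add_sub_assoc, hF g hg, zero_mul]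
        · rw [D.comp_mul_right hx, D.comp_mul_right hx, e']
      | add x x' hx hx' =>
        intro h
        obtain ⟨b, hb, hF, e⟩ := hx h
        obtain ⟨b', hb', hF', e'⟩ := hx' h
        exact ⟨b + b', J.add_mem hb hb', fun g hg => by rw [map_add, hF g hg, hF' g hg, add_zero],
          by rw [mul_add, map_add, map_add, e, e']⟩)

lemma mem_leadingIdeal {J : TwoSidedIdeal D.TGWA} {F : Finset (Fin n → ℤ)} {a : D.TGWA} :
    a ∈ D.leadingIdeal J F ↔
      ∀ h, ∃ b ∈ J, (∀ g ∉ F, D.comp (g + h) b = 0) ∧ D.comp h b = D.comp h a :=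
  TwoSidedIdeal.mem_mk' _ _ _ _ _ _ _

/-- Among the nonzero elements of `J` of minimal support size there is one with a nonzero component
in degree `0`: multiplying by a regular homogeneous element shifts the support. -/
lemma exists_minimal_supp (hreg : D.IsRegularlyGraded) {J : TwoSidedIdeal D.TGWA} (hJ : J ≠ ⊥) :
    ∃ a ∈ J, D.comp 0 a ≠ 0 ∧ ∀ b ∈ J, (D.supp b).card < (D.supp a).card → b = 0 := by
  obtain ⟨a₀, ha₀, hne₀⟩ : ∃ a ∈ J, a ≠ 0 := by
    by_contra! h
    exact hJ (eq_bot_iff.2 fun a ha => (TwoSidedIdeal.mem_bot D.TGWA).2 (h a ha))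
  obtain ⟨a, ⟨ha, hne⟩, hmin⟩ := (measure fun a : D.TGWA => (D.supp a).card).wf.has_min
    {a | a ∈ J ∧ a ≠ 0} ⟨a₀, ha₀, hne₀⟩
  obtain ⟨g, hg⟩ : ∃ g, D.comp g a ≠ 0 := by
    by_contra! h
    exact hne (D.eq_of_comp_eq fun g => by rw [h g, map_zero])
  obtain ⟨z, hz, hzr⟩ := hreg (-g)
  have hcard : (D.supp (a * z)).card ≤ (D.supp a).card := by
    refine Finset.card_le_card_of_injOn (· + g) (fun h hh => ?_)
      fun _ _ _ _ h => add_right_cancel h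
    rw [Finset.mem_coe, mem_supp] at hh ⊢
    rw [D.comp_mul_right hz, sub_neg_eq_add] at hh
    exact fun h0 => hh (by rw [h0, zero_mul])
  refine ⟨a * z, J.mul_mem_right _ _ ha, ?_, fun b hb hlt => ?_⟩
  · rw [D.comp_mul_right hz, sub_neg_eq_add, zero_add]
    exact fun h => hg (hzr.right (h.trans (zero_mul z).symm))
  · by_contra hb0
    exact hmin b ⟨hb, hb0⟩ (hlt.trans_le hcard)

/-- The three conditions imply simplicity. An element of `J` of minimal support can be normalised
to have component `1` in degree `0`; its commutators with homogeneous elements then have smaller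
support, so that it is central, hence equal to `1`. -/
lemma Admissible.isSimpleRing (hD : D.Admissible)
    (ht : ∀ (i : Fin n) (d : ℕ), 0 < d →
      Ideal.span {(D.sigma i ^ d) (D.t i)} ⊔ Ideal.span {D.t i} = ⊤)
    (hZ : D.IsZnSimple) (hcenter : Subalgebra.center k D.TGWA ≤ D.ofCoeff.range) :
    IsSimpleRing D.TGWA := by
  have := hZ.1
  have hnt : Nontrivial D.TGWA := hD.inj.nontrivial
  refine ⟨{ exists_pair_ne := ⟨⊥, ⊤, fun h => ?_⟩, eq_bot_or_eq_top := fun J => ?_ }⟩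
  · have h1 : (1 : D.TGWA) ∈ (⊥ : TwoSidedIdeal D.TGWA) := h ▸ trivial
    exact one_ne_zero ((TwoSidedIdeal.mem_bot _).1 h1)
  refine or_iff_not_imp_left.2 fun hJ => ?_
  obtain ⟨a, ha, ha0, hmin⟩ := exists_minimal_supp hD.reg hJ
  obtain ⟨r, hr⟩ := comp_zero_eq a
  have hr0 : r ≠ 0 := by
    rintro rfl
    exact ha0 (hr.trans (map_zero _))
  have hrJ : D.ofCoeff r ∈ D.leadingIdeal J (D.supp a) := by
    rw [mem_leadingIdeal]
    intro h
    by_cases h0 : h = 0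
    · subst h0
      refine ⟨a, ha, fun g hg => ?_, ?_⟩
      · rw [add_zero]; rwa [mem_supp, not_not] at hg
      · rw [D.comp_of_mem (D.ofCoeff_mem r), if_pos rfl, hr]
    · exact ⟨0, J.zero_mem, by simp, by
        rw [D.comp_of_mem (D.ofCoeff_mem r), if_neg (Ne.symm h0), map_zero]⟩
  obtain ⟨v, hv⟩ := hD.exists_xs_mem hZ hr0 hrJ
  obtain ⟨b, hb, hF, hb0⟩ := mem_leadingIdeal.1 (hD.one_mem_of_xs_mem ht hv) 0
  simp only [add_zero] at hF
  rw [D.comp_of_mem D.one_mem_component, if_pos rfl] at hb0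
  have hcomm : ∀ y, y * b = b * y := by
    intro y
    induction y using D.homogeneous_induction with
    | hom e y hy =>
      have hc : ∀ g, D.comp (g + e) (y * b - b * y) = y * D.comp g b - D.comp g b * y := by
        intro g
        rw [map_sub, D.comp_mul_left hy, D.comp_mul_right hy, add_sub_cancel_right]
      refine sub_eq_zero.1 (hmin _ (J.sub_mem (J.mul_mem_left _ _ hb) (J.mul_mem_right _ _ hb)) ?_)
      have hlt : ((D.supp a).erase 0).card < (D.supp a).card :=
        Finset.card_erase_lt_of_mem (D.mem_supp.2 ha0)
      refine lt_of_le_of_lt (Finset.card_le_card_of_injOn (· - e) (fun g hg => ?_)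
        fun _ _ _ _ h => sub_left_injective h) hlt
      rw [Finset.mem_coe, mem_supp, ← sub_add_cancel g e, hc] at hg
      rw [Finset.mem_coe, Finset.mem_erase]
      refine ⟨fun h0 => hg ?_, by_contra fun h0 => hg ?_⟩
      · change g - e = 0 at h0
        rw [h0, hb0, mul_one, one_mul, sub_self]
      · rw [hF _ h0, mul_zero, zero_mul, sub_self]
    | add y y' h h' => rw [add_mul, h, h', mul_add]
  obtain ⟨s, hs⟩ := hcenter (Subalgebra.mem_center_iff.2 hcomm)
  have hs' : D.ofCoeff s = b := hs
  rw [← hs', D.comp_of_mem (D.ofCoeff_mem s), if_pos rfl, hs'] at hb0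
  exact (TwoSidedIdeal.one_mem_iff J).1 (hb0 ▸ hb)

end TGWDatum

/-- Simplicity of twisted generalized Weyl algebras of Lie type `(A_1)^n`. -/
theorem theorem6p10 {k R : Type*} [CommRing k] [CommRing R] [Algebra k R] {n : ℕ}
    (D : TGWDatum k R n)
    (hinj : Function.Injective D.iota)
    (hreg : D.IsRegularlyGraded)
    (hfin : D.IsFinitistic)
    (hLie : D.IsLieTypeA1) :
    IsSimpleRing D.TGWA ↔
      (∀ (i : Fin n) (d : ℕ), 0 < d →
        Ideal.span {(D.sigma i ^ d) (D.t i)} ⊔ Ideal.span {D.t i} = ⊤) ∧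
      D.IsZnSimple ∧
      (Subalgebra.center k D.TGWA ≤ D.ofCoeff.range) := by
  have hD := TGWDatum.Admissible.of_hyp hinj hreg hfin hLie
  constructor
  · intro h
    exact ⟨fun i d hd => hD.sup_eq_top i hd, hD.isZnSimple, TGWDatum.center_le⟩
  · rintro ⟨ht, hZ, hcenter⟩
    exact hD.isSimpleRing ht hZ hcenter
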